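/- Let $k$ be a field, $R=k[x,y]$ with the lexicographic term order induced by $x>y$, and let $E\subsetneq R$ be a monomial ideal with $\dim_k R/E<\infty$. For an ideal $I$ let $\operatorname{Lt}(I)$ be the ideal generated by the leading terms of the elements of $I$. For every extension field $K\supseteq k$ (with $E_K=E\,K[x,y]$) define sets of ideals of $K[x,y]$: $$V_0=\{I:\operatorname{Lt}(I)=E_K\},\quad V_1=\{I\in V_0: y\in\sqrt I\},\quad V_2=\{I\in V_0:\sqrt I=(x,y)\},\quad V_3=\{I\in V_0: I\text{ homogeneous}\}.$$ *Variety structure.* For each minimal monomial generator $m$ of $E$ and parameters $\lambda=(\lambda(m,m'))$ put $f_m=m-\sum\lambda(m,m')m'$, the sum being over the monomials $m'\notin E$ with $m'<m$. Let $X\subseteq\mathbf A^N$ be the set of those $\lambda$ for which the ideal $I_\lambda=(f_m)_m$ satisfies $\operatorname{Lt}(I_\lambda)=E_K$. Then $\lambda\mapsto I_\lambda$ is a bijection $X(K)\to V_0$ for every $K$; so $V_0$ is regarded as the subset $X$ of $\mathbf A^N$, whose coordinates are the coefficients of the reduced Gröbner basis. *Index set.* Let $t=\min\{j:x^j\in E\}$,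 $m_i=\min\{j:x^{t-i}y^j\in E\}$ for $0\le i\le t$, $d_j=m_j-m_{j-1}$ for $1\le j\le t$, $u_{ij}=m_j-m_{i-1}+i-j$ for $1\le i\le t+1$, $1\le j\le t$, and $$\mathcal S(E)=\{(i,j):1\le j<i\le t+1,\ 0\le u_{ij}<d_j\}.$$ *Claim.* $V_0$ is an affine space, and $V_1,V_2,V_3$ are coordinate subspaces of it: there are $n$, polynomial maps $P:\mathbf A^n\to\mathbf A^N$ and $Q:\mathbf A^N\to\mathbf A^n$ with coefficients in $k$, and subsets $J_1,J_2,J_3\subseteq\{1,\dots,n\}$ such that, over every extension field $K$ of $k$, $P$ maps $K^n$ bijectively onto $X(K)$ with inverse $Q|_{X(K)}$, and for $i=1,2,3$ and $z\in K^n$ one has $I_{P(z)}\in V_i$ if and only if $z_j=0$ for all $j\notin J_i$. The dimensions $\dim V_0=n$ and $\dim V_i=\#J_i$ are - $\dim V_0=\dim_k R/E+\min\{j:y^j\in E\}$; - $\dim V_1=\dim_k R/E$; - $\dim V_2=\dim_k R/E-\min\{j:x^j\in E\}$; - $\dim V_3=\#\mathcal S(E)$. -/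

import Mathlib

universe u

namespace GroebnerCell

open MvPolynomial
open scoped MonomialOrder

/-- The polynomial ring `k[x,y]`, with `x = X 0` and `y = X 1`. -/
abbrev Poly (k : Type u) [Field k] : Type u := MvPolynomial (Fin 2) k

/-- Exponent vectors of the monomials in `x`, `y`; the pointwise order is divisibility. -/
abbrev Mon : Type := Fin 2 →₀ ℕ

/-- The lexicographic term order induced by `x > y`. -/
noncomputable abbrev lexOrder : MonomialOrder (Fin 2) := MonomialOrder.lex

theorem y_lt_x : (Finsupp.single 1 1 : Mon) ≺[lexOrder] (Finsupp.single 0 1 : Mon) := by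
  rw [MonomialOrder.lex_lt_iff, Finsupp.Lex.single_lt_iff]
  decide

/-- An ideal generated by monomials. -/
def IsMonomialIdeal {k : Type u} [Field k] (E : Ideal (Poly k)) : Prop :=
  ∃ S : Set Mon, E = Ideal.span ((fun a : Mon => (monomial a (1 : k) : Poly k)) '' S)

/-- `Lt(I)`: the ideal generated by the leading terms of the elements of `I`. -/
noncomputable def leadingIdeal {k : Type u} [Field k] (I : Ideal (Poly k)) : Ideal (Poly k) :=
  Ideal.span (lexOrder.leadingTerm '' (I : Set (Poly k)))

/-- The ideals with leading term ideal `E`. -/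
def V₀ {k : Type u} [Field k] (E : Ideal (Poly k)) : Set (Ideal (Poly k)) :=
  {I | leadingIdeal I = E}

/-- The ideals of `V₀ E` whose radical contains `y`. -/
def V₁ {k : Type u} [Field k] (E : Ideal (Poly k)) : Set (Ideal (Poly k)) :=
  {I | leadingIdeal I = E ∧ X 1 ∈ I.radical}

/-- The ideals of `V₀ E` whose radical is `(x, y)`. -/
def V₂ {k : Type u} [Field k] (E : Ideal (Poly k)) : Set (Ideal (Poly k)) :=
  {I | leadingIdeal I = E ∧ I.radical = Ideal.span {X 0, X 1}}

attribute [local instance] MvPolynomial.gradedAlgebra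

/-- The homogeneous ideals of `V₀ E` (standard grading). -/
def V₃ {k : Type u} [Field k] (E : Ideal (Poly k)) : Set (Ideal (Poly k)) :=
  {I | leadingIdeal I = E ∧ I.IsHomogeneous (homogeneousSubmodule (Fin 2) k)}

/-! ### The structure of affine variety on `V₀ E` -/

/-- The minimal monomial generators of the monomial ideal `E`. -/
def MinGen {k : Type u} [Field k] (E : Ideal (Poly k)) : Type :=
  {m : Mon // Minimal (fun a : Mon => (monomial a (1 : k) : Poly k) ∈ E) m}

/-- The monomials outside `E` that are smaller than `m`. -/
def Tail {k : Type u} [Field k] (E : Ideal (Poly k)) (m : Mon) : Type :=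
  {a : Mon // (monomial a (1 : k) : Poly k) ∉ E ∧ a ≺[lexOrder] m}

/-- If `k[x,y]/E` is finite dimensional, the sum over `Tail E m` below is a finite sum. -/
theorem finite_tail {k : Type u} [Field k] {E : Ideal (Poly k)} (hmon : IsMonomialIdeal E)
    (hfin : Module.Finite k (Poly k ⧸ E)) (m : Mon) : Finite (Tail E m) := by
  have hli : LinearIndependent k
      (fun a : Tail E m => (Ideal.Quotient.mkₐ k E).toLinearMap (monomial a.1 (1 : k))) := by
    have h1 : LinearIndependent k (fun a : Tail E m => (monomial a.1 (1 : k) : Poly k)) := by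
      have := (MvPolynomial.basisMonomials (Fin 2) k).linearIndependent.comp
        (fun a : Tail E m => a.1) Subtype.val_injective
      simpa [Function.comp_def] using this
    refine h1.map ?_
    rw [Submodule.disjoint_def]
    intro f hf hker
    have hfE : f ∈ E := by
      have : Ideal.Quotient.mk E f = 0 := by simpa using hker
      exact Ideal.Quotient.eq_zero_iff_mem.mp this
    obtain ⟨S, rfl⟩ := hmon
    have hsupp : ∀ a ∈ f.support, (monomial a (1 : k) : Poly k) ∉
        Ideal.span ((fun a : Mon => (monomial a (1 : k) : Poly k)) '' S) := by
      have hle : Submodule.span k (Set.range fun a : Tail (Ideal.span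
          ((fun a : Mon => (monomial a (1 : k) : Poly k)) '' S)) m =>
          (monomial a.1 (1 : k) : Poly k)) ≤ MvPolynomial.restrictSupport k
            {a : Mon | (monomial a (1 : k) : Poly k) ∉
              Ideal.span ((fun a : Mon => (monomial a (1 : k) : Poly k)) '' S)} := by
        rw [Submodule.span_le]
        rintro _ ⟨a, rfl⟩ b hb
        have := MvPolynomial.support_monomial_subset hb
        rw [Finset.mem_singleton] at this
        rw [this]
        exact a.2.1
      intro a ha
      exact hle hf ha
    by_contra hne
    obtain ⟨a, ha⟩ := MvPolynomial.support_nonempty.mpr hne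
    refine hsupp a ha ?_
    rw [mem_ideal_span_monomial_image] at hfE ⊢
    intro b hb
    have := MvPolynomial.support_monomial_subset hb
    rw [Finset.mem_singleton] at this
    rw [this]
    exact hfE a ha
  exact hli.finite

/-- The index set of the coordinates `λ(m, m')` of the ambient affine space `𝔸ᴺ`. -/
def Coord {k : Type u} [Field k] (E : Ideal (Poly k)) : Type :=
  Σ m : MinGen E, Tail E m.1

/-- The extension of an ideal of `k[x,y]` to `K[x,y]`, for a field extension `K` of `k`. -/
noncomputable def baseChange {k : Type u} [Field k] (K : Type u) [Field K] [Algebra k K]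
    (E : Ideal (Poly k)) : Ideal (Poly K) :=
  E.map (MvPolynomial.map (algebraMap k K))

theorem baseChange_self {k : Type u} [Field k] (E : Ideal (Poly k)) : baseChange k E = E := by
  have h : (MvPolynomial.map (algebraMap k k) : Poly k →+* Poly k) = RingHom.id _ := by
    ext <;> simp
  rw [baseChange, h, Ideal.map_id]

/-- The polynomial `f_m = m - ∑ λ(m, m') m'` with coefficients `λ = c` in `K`. -/
noncomputable def cellPoly {k : Type u} [Field k] (E : Ideal (Poly k))
    {K : Type u} [Field K] (c : Coord E → K) (m : MinGen E) : Poly K :=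
  monomial m.1 1 - ∑ᶠ a : Tail E m.1, monomial a.1 (c ⟨m, a⟩)

/-- The ideal generated by the polynomials `f_m`. -/
noncomputable def cellIdeal {k : Type u} [Field k] (E : Ideal (Poly k))
    {K : Type u} [Field K] (c : Coord E → K) : Ideal (Poly K) :=
  Ideal.span (Set.range (cellPoly E c))

/-- The `K`-points of the affine variety of the coefficient vectors for which the polynomials
`f_m` are a (then automatically reduced) Gröbner basis of an ideal with leading term ideal `E`. -/
def cell {k : Type u} [Field k] (E : Ideal (Poly k))
    (K : Type u) [Field K] [Algebra k K] : Set (Coord E → K) :=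
  {c | leadingIdeal (cellIdeal E c) = baseChange K E}

/-- The map on `K`-points of affine spaces given by a family of polynomials over `k`. -/
noncomputable def polyMap {k : Type u} [Field k] {σ τ : Type} (P : τ → MvPolynomial σ k)
    (K : Type u) [Field K] [Algebra k K] (z : σ → K) : τ → K :=
  fun b => aeval z (P b)

/-! ### The set `𝒮(E)` -/

/-- `min {j : x ^ j ∈ E}`. -/
noncomputable def xMin {k : Type u} [Field k] (E : Ideal (Poly k)) : ℕ :=
  sInf {j | (X 0 : Poly k) ^ j ∈ E}

/-- `min {j : y ^ j ∈ E}`. -/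
noncomputable def yMin {k : Type u} [Field k] (E : Ideal (Poly k)) : ℕ :=
  sInf {j | (X 1 : Poly k) ^ j ∈ E}

/-- `m_i = min {j : x ^ (t - i) y ^ j ∈ E}` for `0 ≤ i ≤ t`, where `t = xMin E`. -/
noncomputable def mSeq {k : Type u} [Field k] (E : Ideal (Poly k)) (i : ℕ) : ℕ :=
  sInf {j | (X 0 : Poly k) ^ (xMin E - i) * X 1 ^ j ∈ E}

/-- `d_j = m_j - m_{j-1}` for `1 ≤ j ≤ t`. -/
noncomputable def dSeq {k : Type u} [Field k] (E : Ideal (Poly k)) (j : ℕ) : ℤ :=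
  (mSeq E j : ℤ) - mSeq E (j - 1)

/-- The entries `u_{ij} = m_j - m_{i-1} + i - j` of the degree matrix,
for `1 ≤ i ≤ t + 1` and `1 ≤ j ≤ t`. -/
noncomputable def degMatrix {k : Type u} [Field k] (E : Ideal (Poly k)) (i j : ℕ) : ℤ :=
  (mSeq E j : ℤ) - mSeq E (i - 1) + i - j

/-- `𝒮(E) = {(i, j) : 1 ≤ j < i ≤ t + 1, 0 ≤ u_{ij} < d_j}`. -/
noncomputable def indexSet {k : Type u} [Field k] (E : Ideal (Poly k)) : Set (ℕ × ℕ) :=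
  {p | 1 ≤ p.2 ∧ p.2 < p.1 ∧ p.1 ≤ xMin E + 1 ∧
    0 ≤ degMatrix E p.1 p.2 ∧ degMatrix E p.1 p.2 < dSeq E p.2}

end GroebnerCell

/-! View `K[x,y]` as `K[y][x]` and let `h a` be the least `b` with `x^a y^b ∈ E`. It is antitone,
positive for `a < t` and zero at `t`. An ideal has leading ideal `E` exactly when it contains an
adapted family (`F s` of `x`-degree `s`, with `x^s`-coefficient monic of degree `h s`) and no
nonzero polynomial supported under the staircase (`leadingIdeal_eq_iff`). Such an `F` is a
`K[y]`-basis of the ideal, so multiplication by `x` is a matrix over `K[y]`: `x F_s = ∑_{l ≤ s}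
N_{s,l} F_l + p_s F_{s+1}`, with `p_s` monic of degree `h s - h (s+1)`.

Adding multiples of `F_l`, `l ≤ s`, to `F_{s+1}` changes `N_{s,l}` modulo `p_s`, so every ideal of
the cell has exactly one family in which all `N_{s,l}`, and the non-leading part `N_{s,s+1}` of
`p_s`, have degree below `h s - h (s+1)` (`IsAdapted.isCanonical`, `IsCanonical.unique`). Conversely
every matrix with these bounds occurs: a Hilbert–Burch type recursion writes the `F_s` as products
of diagonal entries and cofactors (`isCanonical_syzFamily`), and this is the only solution
(`IsCanonical.eq_syzFamily`). The coefficients of `N` are therefore free coordinates, `s + 2`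
entries with `h s - h (s+1)` coefficients for each `s`.

Passing between `N` and the reduced Gröbner basis uses only division by monic polynomials, which
commutes with ring maps. Carrying it out once with indeterminate coefficients gives `P` and `Q`,
valid over every `K`.

The three subsets are visible in `N`. Since `F_0 = ∏ p_r` generates `I ∩ K[y]`, the condition `y ∈
√I` means `p_r = y^(h r - h (r+1))`, that is `N_{r,r+1} = 0`. Given this, reducing modulo `y` turns
the last cofactor into a polynomial in `x` that must be `x^t` for `x ∈ √I`; this kills the constant
terms `N_{s,l}(0)` with `h l = h s`, one for each `l < t`. Finally `I` is homogeneous iff each `F_s`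
is homogeneous of degree `h s + s`, which leaves at most one possible monomial in each entry. -/

namespace GroebnerCell

/-! ### Division with remainder by an adapted family. -/

section Division

open Polynomial

variable {A : Type*} [CommRing A]

/-- All monomials `x ^ a * y ^ b` of `r` lie under the staircase `h`, that is `b < h a`.
Here `x` is the outer and `y` the inner variable. -/
def IsReduced (h : ℕ → ℕ) (r : A[X][X]) : Prop :=
  ∀ s, (r.coeff s).degree < h s

/-- `F s` has `x`-degree `s`, with a monic leading coefficient of degree `h s`. -/
structure IsAdapted (h : ℕ → ℕ) (F : ℕ → A[X][X]) : Prop where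
  natDegree_le : ∀ s, (F s).natDegree ≤ s
  monic : ∀ s, ((F s).coeff s).Monic
  natDegree_coeff : ∀ s, ((F s).coeff s).natDegree = h s

/-- Division with remainder of `f` by the first `n` members of an adapted family. -/
structure IsDivision (h : ℕ → ℕ) (F : ℕ → A[X][X]) (n : ℕ) (f : A[X][X])
    (q : ℕ → A[X]) (r : A[X][X]) : Prop where
  eq : f = ∑ s ∈ Finset.range n, q s • F s + r
  reduced : IsReduced h r
  quot_eq_zero : ∀ s, n ≤ s → q s = 0
  coeff_eq_zero : ∀ s, n ≤ s → r.coeff s = 0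

theorem IsReduced.add {h : ℕ → ℕ} {r r' : A[X][X]} (hr : IsReduced h r) (hr' : IsReduced h r') :
    IsReduced h (r + r') := fun s => by
  rw [coeff_add]
  exact (degree_add_le _ _).trans_lt (max_lt (hr s) (hr' s))

theorem IsReduced.neg {h : ℕ → ℕ} {r : A[X][X]} (hr : IsReduced h r) : IsReduced h (-r) :=
  fun s => by rw [coeff_neg, degree_neg]; exact hr s

theorem IsReduced.sub {h : ℕ → ℕ} {r r' : A[X][X]} (hr : IsReduced h r) (hr' : IsReduced h r') :
    IsReduced h (r - r') := by
  rw [sub_eq_add_neg]; exact hr.add hr'.neg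

theorem isReduced_zero (h : ℕ → ℕ) : IsReduced h (0 : A[X][X]) := fun s => by
  rw [coeff_zero, degree_zero]; exact WithBot.bot_lt_coe _

theorem IsReduced.map {h : ℕ → ℕ} {A' : Type*} [CommRing A'] (φ : A →+* A') {r : A[X][X]}
    (hr : IsReduced h r) : IsReduced h (r.map (mapRingHom φ)) := fun s => by
  rw [coeff_map, coe_mapRingHom]
  exact degree_map_le.trans_lt (hr s)

namespace IsAdapted

variable {h : ℕ → ℕ} {F : ℕ → A[X][X]}

theorem coeff_eq_zero (hF : IsAdapted h F) {s a : ℕ} (hsa : s < a) : (F s).coeff a = 0 :=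
  coeff_eq_zero_of_natDegree_lt ((hF.natDegree_le s).trans_lt hsa)

theorem coeff_sum (hF : IsAdapted h F) (q : ℕ → A[X]) (n : ℕ) :
    (∑ s ∈ Finset.range (n + 1), q s • F s).coeff n = q n * (F n).coeff n := by
  rw [finsetSum_coeff, Finset.sum_range_succ, Finset.sum_eq_zero, zero_add, coeff_smul,
    smul_eq_mul]
  intro s hs
  rw [coeff_smul, hF.coeff_eq_zero (Finset.mem_range.1 hs), smul_zero]

theorem coeff_sum_eq_zero (hF : IsAdapted h F) (q : ℕ → A[X]) {n a : ℕ} (hna : n ≤ a) :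
    (∑ s ∈ Finset.range n, q s • F s).coeff a = 0 := by
  rw [finsetSum_coeff, Finset.sum_eq_zero]
  intro s hs
  rw [coeff_smul, hF.coeff_eq_zero ((Finset.mem_range.1 hs).trans_le hna), smul_zero]

theorem degree_coeff [Nontrivial A] (hF : IsAdapted h F) (s : ℕ) :
    ((F s).coeff s).degree = h s := by
  rw [degree_eq_natDegree (hF.monic s).ne_zero, hF.natDegree_coeff]

theorem map {A' : Type*} [CommRing A'] [Nontrivial A'] (φ : A →+* A') (hF : IsAdapted h F) :
    IsAdapted h (fun s => (F s).map (mapRingHom φ)) where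
  natDegree_le s := natDegree_map_le.trans (hF.natDegree_le s)
  monic s := by rw [coeff_map]; exact (hF.monic s).map φ
  natDegree_coeff s := by
    rw [coeff_map, coe_mapRingHom, (hF.monic s).natDegree_map, hF.natDegree_coeff]

/-- In the coefficient of `x^n` only `q n` and `r` contribute. A nonzero `q n` times a monic
polynomial of degree `h n` has degree at least `h n`, too large to cancel against a reduced
coefficient. This gives both uniqueness of division and linear independence of `F`. -/
theorem eq_zero_of_sum_add_eq_zero [Nontrivial A] (hF : IsAdapted h F) (q : ℕ → A[X])
    {r : A[X][X]} (hr : IsReduced h r) (n : ℕ)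
    (heq : ∑ s ∈ Finset.range n, q s • F s + r = 0) : (∀ s < n, q s = 0) ∧ r = 0 := by
  induction n with
  | zero => simpa using heq
  | succ n ih =>
    have hc : q n * (F n).coeff n = - r.coeff n := by
      have := congrArg (fun f => coeff f n) heq
      simp only [coeff_add, hF.coeff_sum, coeff_zero] at this
      exact eq_neg_of_add_eq_zero_left this
    have hq : q n = 0 := by
      by_contra hne
      have h1 : (q n * (F n).coeff n).degree < h n := by rw [hc, degree_neg]; exact hr n
      rw [(hF.monic n).degree_mul, hF.degree_coeff, degree_eq_natDegree hne, ← Nat.cast_add,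
        Nat.cast_lt] at h1
      omega
    rw [Finset.sum_range_succ, hq, zero_smul, add_zero] at heq
    obtain ⟨h1, h2⟩ := ih heq
    refine ⟨fun s hs => ?_, h2⟩
    rcases Nat.lt_succ_iff_lt_or_eq.1 hs with hs | rfl
    exacts [h1 s hs, hq]

theorem eq_zero_of_sum_eq_zero [Nontrivial A] (hF : IsAdapted h F) (q : ℕ → A[X]) (n : ℕ)
    (heq : ∑ s ∈ Finset.range n, q s • F s = 0) : ∀ s < n, q s = 0 :=
  (hF.eq_zero_of_sum_add_eq_zero q (isReduced_zero h) n (by rw [heq, add_zero])).1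

/-- Work down in `x`-degree: divide the top coefficient by the monic coefficient of `F n`, keep the
remainder, and continue with what is left in lower `x`-degree. No field is needed. -/
theorem exists_isDivision [Nontrivial A] (hF : IsAdapted h F) (n : ℕ) (f : A[X][X])
    (hf : ∀ s, n ≤ s → f.coeff s = 0) : ∃ q r, IsDivision h F n f q r := by
  induction n generalizing f with
  | zero =>
    refine ⟨0, 0, ?_, isReduced_zero h, fun _ _ => rfl, fun _ _ => coeff_zero _⟩
    ext1 s
    simp [hf s (Nat.zero_le s)]
  | succ n ih =>
    set c := f.coeff n /ₘ (F n).coeff n with hcdef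
    set e := f.coeff n %ₘ (F n).coeff n with hedef
    obtain ⟨q, r, hq⟩ := ih (f - c • F n - monomial n e) (fun s hs => by
      rcases hs.eq_or_lt with rfl | hs
      · rw [coeff_sub, coeff_sub, coeff_smul, coeff_monomial, if_pos rfl, smul_eq_mul,
          sub_sub, add_comm, mul_comm, hcdef, hedef, modByMonic_add_div, sub_self]
      · rw [coeff_sub, coeff_sub, coeff_smul, coeff_monomial, if_neg hs.ne, hf s hs,
          hF.coeff_eq_zero hs]
        simp)
    refine ⟨Function.update q n c, r + monomial n e, ?_, hq.reduced.add ?_, fun s hs => ?_,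
      fun s hs => ?_⟩
    · have h1 : ∑ s ∈ Finset.range n, Function.update q n c s • F s =
          ∑ s ∈ Finset.range n, q s • F s := Finset.sum_congr rfl fun s hs => by
        rw [Function.update_of_ne (Finset.mem_range.1 hs).ne]
      rw [Finset.sum_range_succ, Function.update_self, h1]
      linear_combination hq.eq
    · intro s
      rw [coeff_monomial]
      split_ifs with hns
      · subst hns
        exact (degree_modByMonic_lt _ (hF.monic n)).trans_eq (hF.degree_coeff n)
      · rw [degree_zero]; exact WithBot.bot_lt_coe _
    · rw [Function.update_of_ne (Nat.lt_of_succ_le hs).ne', hq.quot_eq_zero s (by omega)]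
    · rw [coeff_add, hq.coeff_eq_zero s (by omega), coeff_monomial,
        if_neg (Nat.lt_of_succ_le hs).ne, add_zero]

end IsAdapted

namespace IsDivision

variable {h : ℕ → ℕ} {F : ℕ → A[X][X]} {n : ℕ} {f : A[X][X]} {q q' : ℕ → A[X]} {r r' : A[X][X]}

theorem unique [Nontrivial A] (hF : IsAdapted h F) (H : IsDivision h F n f q r)
    (H' : IsDivision h F n f q' r') : q = q' ∧ r = r' := by
  have key := hF.eq_zero_of_sum_add_eq_zero (fun s => q s - q' s) (H.reduced.sub H'.reduced) n (by
    simp only [sub_smul, Finset.sum_sub_distrib]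
    linear_combination H'.eq - H.eq)
  refine ⟨funext fun s => ?_, sub_eq_zero.1 key.2⟩
  rcases lt_or_ge s n with hs | hs
  · exact sub_eq_zero.1 (key.1 s hs)
  · rw [H.quot_eq_zero s hs, H'.quot_eq_zero s hs]

theorem map {A' : Type*} [CommRing A'] (φ : A →+* A') (H : IsDivision h F n f q r) :
    IsDivision h (fun s => (F s).map (mapRingHom φ)) n (f.map (mapRingHom φ))
      (fun s => (q s).map φ) (r.map (mapRingHom φ)) where
  eq := by
    conv_lhs => rw [H.eq]
    simp [Polynomial.map_sum, smul_eq_C_mul]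
  reduced := H.reduced.map φ
  quot_eq_zero s hs := by rw [H.quot_eq_zero s hs, Polynomial.map_zero]
  coeff_eq_zero s hs := by rw [coeff_map, H.coeff_eq_zero s hs, RingHom.map_zero]

end IsDivision

open Classical in
/-- The quotients and the remainder of the division of `f` by the first `n` members of `F`. -/
noncomputable def division (h : ℕ → ℕ) (F : ℕ → A[X][X]) (n : ℕ) (f : A[X][X]) :
    (ℕ → A[X]) × A[X][X] :=
  if H : ∃ p : (ℕ → A[X]) × A[X][X], IsDivision h F n f p.1 p.2 then H.choose else 0

theorem IsAdapted.isDivision [Nontrivial A] {h : ℕ → ℕ} {F : ℕ → A[X][X]} (hF : IsAdapted h F)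
    {n : ℕ} {f : A[X][X]} (hf : ∀ s, n ≤ s → f.coeff s = 0) :
    IsDivision h F n f (division h F n f).1 (division h F n f).2 := by
  have H : ∃ p : (ℕ → A[X]) × A[X][X], IsDivision h F n f p.1 p.2 := by
    obtain ⟨q, r, hqr⟩ := hF.exists_isDivision n f hf
    exact ⟨(q, r), hqr⟩
  rw [division, dif_pos H]
  exact H.choose_spec

/-- The image of a division is again a division, so uniqueness identifies it with the division of
the image. This compatibility with specialization is what makes both coordinate changes polynomial.
-/
theorem IsAdapted.division_map [Nontrivial A] {A' : Type*} [CommRing A'] [Nontrivial A']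
    (φ : A →+* A') {h : ℕ → ℕ} {F : ℕ → A[X][X]} (hF : IsAdapted h F)
    {n : ℕ} {f : A[X][X]} (hf : ∀ s, n ≤ s → f.coeff s = 0) :
    division h (fun s => (F s).map (mapRingHom φ)) n (f.map (mapRingHom φ)) =
      (fun s => ((division h F n f).1 s).map φ, (division h F n f).2.map (mapRingHom φ)) := by
  have hF' := hF.map φ
  have H := hF'.isDivision (n := n) (f := f.map (mapRingHom φ)) (fun s hs => by
    rw [coeff_map, hf s hs, RingHom.map_zero])
  exact Prod.ext_iff.2 (H.unique hF' ((hF.isDivision hf).map φ))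

/-- An ideal without nonzero reduced elements. -/
def NoReduced (h : ℕ → ℕ) (I : Ideal A[X][X]) : Prop :=
  ∀ r ∈ I, IsReduced h r → r = 0

theorem smul_mem_ideal (I : Ideal A[X][X]) (c : A[X]) {f : A[X][X]} (hf : f ∈ I) : c • f ∈ I := by
  rw [smul_eq_C_mul]; exact I.mul_mem_left _ hf

theorem sum_smul_mem_ideal {I : Ideal A[X][X]} {F : ℕ → A[X][X]} (hF : ∀ s, F s ∈ I)
    (q : ℕ → A[X]) (n : ℕ) : ∑ s ∈ Finset.range n, q s • F s ∈ I :=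
  Ideal.sum_mem _ fun s _ => smul_mem_ideal I _ (hF s)

/-- In an ideal without reduced elements, every element is a combination of an adapted family. -/
theorem NoReduced.exists_eq_sum [Nontrivial A] {h : ℕ → ℕ} {I : Ideal A[X][X]}
    (hI : NoReduced h I) {F : ℕ → A[X][X]} (hF : IsAdapted h F) (hFI : ∀ s, F s ∈ I)
    {f : A[X][X]} (hf : f ∈ I) {n : ℕ} (hn : ∀ s, n ≤ s → f.coeff s = 0) :
    ∃ q : ℕ → A[X], f = ∑ s ∈ Finset.range n, q s • F s := by
  obtain ⟨q, r, H⟩ := hF.exists_isDivision n f hn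
  have hr : r = 0 := hI r (by
    rw [show r = f - ∑ s ∈ Finset.range n, q s • F s by linear_combination -H.eq]
    exact I.sub_mem hf (sum_smul_mem_ideal hFI q n)) H.reduced
  exact ⟨q, by rw [H.eq, hr, add_zero]⟩

theorem coeff_eq_zero_of_natDegree_succ_le (f : A[X][X]) :
    ∀ s, f.natDegree + 1 ≤ s → f.coeff s = 0 :=
  fun _ hs => coeff_eq_zero_of_natDegree_lt (Nat.lt_of_succ_le hs)

theorem NoReduced.span_eq [Nontrivial A] {h : ℕ → ℕ} {I : Ideal A[X][X]}
    (hI : NoReduced h I) {F : ℕ → A[X][X]} (hF : IsAdapted h F) (hFI : ∀ s, F s ∈ I) :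
    Ideal.span (Set.range F) = I := by
  refine le_antisymm (Ideal.span_le.2 (Set.range_subset_iff.2 hFI)) fun f hf => ?_
  obtain ⟨q, hq⟩ := hI.exists_eq_sum hF hFI hf (coeff_eq_zero_of_natDegree_succ_le f)
  rw [hq]
  exact sum_smul_mem_ideal (fun s => Ideal.subset_span (Set.mem_range_self s)) q _

end Division

end GroebnerCell

namespace GroebnerCell

/-! ### Canonical families and their syzygy matrices. -/

section Canonical

open Polynomial

variable {A : Type*} [CommRing A]

/-- The diagonal entries `y ^ (h s - h (s + 1)) + N s (s + 1)` of the syzygy matrix. -/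
noncomputable def diagEntry (h : ℕ → ℕ) (N : ℕ → ℕ → A[X]) (s : ℕ) : A[X] :=
  X ^ (h s - h (s + 1)) + N s (s + 1)

/-- `F` is an adapted family whose syzygies `x F_s = p_s F_{s+1} + ∑_{l ≤ s} N_{s,l} F_l` have
entries reduced with respect to the diagonal. -/
structure IsCanonical (h : ℕ → ℕ) (F : ℕ → A[X][X]) (N : ℕ → ℕ → A[X]) : Prop where
  adapted : IsAdapted h F
  degree_lt : ∀ s l, l ≤ s + 1 → (N s l).degree < (h s - h (s + 1) : ℕ)
  rel : ∀ s, X * F s = ∑ l ∈ Finset.range (s + 1), N s l • F l + diagEntry h N s • F (s + 1)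

/-- The monic minors of the syzygy matrix with entries `N`. -/
noncomputable def cofactor (h : ℕ → ℕ) (N : ℕ → ℕ → A[X]) : ℕ → A[X][X]
  | 0 => 1
  | s + 1 => X * cofactor h N s -
      ∑ l : Fin (s + 1), (N s l * ∏ r ∈ Finset.Ico (l : ℕ) s, diagEntry h N r) • cofactor h N l

/-- The family of polynomials with syzygy matrix `N`. -/
noncomputable def syzFamily (h : ℕ → ℕ) (t : ℕ) (N : ℕ → ℕ → A[X]) (s : ℕ) : A[X][X] :=
  (∏ r ∈ Finset.Ico s t, diagEntry h N r) • cofactor h N s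

theorem cofactor_zero (h : ℕ → ℕ) (N : ℕ → ℕ → A[X]) : cofactor h N 0 = 1 := by
  rw [cofactor]

theorem cofactor_succ (h : ℕ → ℕ) (N : ℕ → ℕ → A[X]) (s : ℕ) :
    cofactor h N (s + 1) = X * cofactor h N s - ∑ l ∈ Finset.range (s + 1),
      (N s l * ∏ r ∈ Finset.Ico l s, diagEntry h N r) • cofactor h N l := by
  rw [cofactor, Fin.sum_univ_eq_sum_range
    (fun l => (N s l * ∏ r ∈ Finset.Ico l s, diagEntry h N r) • cofactor h N l)]

theorem diagEntry_map {A' : Type*} [CommRing A'] (φ : A →+* A') (h : ℕ → ℕ)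
    (N : ℕ → ℕ → A[X]) (s : ℕ) :
    (diagEntry h N s).map φ = diagEntry h (fun s l => (N s l).map φ) s := by
  simp [diagEntry]

theorem prod_diagEntry_map {A' : Type*} [CommRing A'] (φ : A →+* A') (h : ℕ → ℕ)
    (N : ℕ → ℕ → A[X]) (S : Finset ℕ) :
    (∏ r ∈ S, diagEntry h N r).map φ = ∏ r ∈ S, diagEntry h (fun s l => (N s l).map φ) r := by
  rw [Polynomial.map_prod]
  exact Finset.prod_congr rfl fun r _ => diagEntry_map φ h N r

theorem smul_map {A' : Type*} [CommRing A'] (φ : A →+* A') (c : A[X]) (f : A[X][X]) :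
    (c • f).map (mapRingHom φ) = c.map φ • f.map (mapRingHom φ) := by
  rw [smul_eq_C_mul, smul_eq_C_mul, Polynomial.map_mul, map_C, coe_mapRingHom]

theorem cofactor_map {A' : Type*} [CommRing A'] (φ : A →+* A') (h : ℕ → ℕ)
    (N : ℕ → ℕ → A[X]) (s : ℕ) :
    (cofactor h N s).map (mapRingHom φ) = cofactor h (fun s l => (N s l).map φ) s := by
  induction s using Nat.strong_induction_on with
  | _ s ih =>
    cases s with
    | zero => simp [cofactor_zero]
    | succ s =>
      rw [cofactor_succ, cofactor_succ, Polynomial.map_sub, Polynomial.map_mul, map_X,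
        ih s s.lt_succ_self, Polynomial.map_sum]
      congr 1
      refine Finset.sum_congr rfl fun l hl => ?_
      rw [smul_map, ih l (Finset.mem_range.1 hl), Polynomial.map_mul, prod_diagEntry_map]

theorem syzFamily_map {A' : Type*} [CommRing A'] (φ : A →+* A') (h : ℕ → ℕ) (t : ℕ)
    (N : ℕ → ℕ → A[X]) (s : ℕ) :
    (syzFamily h t N s).map (mapRingHom φ) = syzFamily h t (fun s l => (N s l).map φ) s := by
  rw [syzFamily, smul_map, cofactor_map, prod_diagEntry_map, syzFamily]

theorem natDegree_cofactor_le (h : ℕ → ℕ) (N : ℕ → ℕ → A[X]) (s : ℕ) :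
    (cofactor h N s).natDegree ≤ s := by
  induction s using Nat.strong_induction_on with
  | _ s ih =>
    cases s with
    | zero => simp [cofactor_zero]
    | succ s =>
      rw [cofactor_succ]
      refine (natDegree_sub_le _ _).trans
        (max_le ?_ (natDegree_sum_le_of_forall_le _ _ fun l hl => ?_))
      · refine natDegree_mul_le.trans ?_
        have := ih s s.lt_succ_self
        have := natDegree_X_le (R := A[X])
        omega
      · have hl' := Finset.mem_range.1 hl
        exact (natDegree_smul_le _ _).trans ((ih l hl').trans (by omega))

theorem coeff_cofactor_self (h : ℕ → ℕ) (N : ℕ → ℕ → A[X]) (s : ℕ) :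
    (cofactor h N s).coeff s = 1 := by
  induction s with
  | zero => simp [cofactor_zero]
  | succ s ih =>
    rw [cofactor_succ, coeff_sub, coeff_X_mul, ih, finsetSum_coeff, Finset.sum_eq_zero, sub_zero]
    intro l hl
    rw [coeff_smul, coeff_eq_zero_of_natDegree_lt
      ((natDegree_cofactor_le h N l).trans_lt (Finset.mem_range.1 hl)), smul_zero]

theorem monic_diagEntry {h : ℕ → ℕ} {N : ℕ → ℕ → A[X]} {s : ℕ}
    (hN : (N s (s + 1)).degree < (h s - h (s + 1) : ℕ)) : (diagEntry h N s).Monic :=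
  monic_X_pow_add hN

theorem natDegree_diagEntry [Nontrivial A] {h : ℕ → ℕ} {N : ℕ → ℕ → A[X]} {s : ℕ}
    (hN : (N s (s + 1)).degree < (h s - h (s + 1) : ℕ)) :
    (diagEntry h N s).natDegree = h s - h (s + 1) := by
  rw [diagEntry, natDegree_add_eq_left_of_degree_lt, natDegree_X_pow]
  rwa [degree_X_pow]

theorem sum_Ico_sub_of_antitone {h : ℕ → ℕ} (hh : Antitone h) {s t : ℕ} (hst : s ≤ t) :
    ∑ r ∈ Finset.Ico s t, (h r - h (r + 1)) = h s - h t := by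
  induction t, hst using Nat.le_induction with
  | base => simp
  | succ t hst ih =>
    rw [Finset.sum_Ico_succ_top hst, ih]
    have := hh hst
    have := hh (Nat.le_add_right t 1)
    omega

theorem monic_prod_diagEntry {h : ℕ → ℕ} {N : ℕ → ℕ → A[X]}
    (hN : ∀ s, (N s (s + 1)).degree < (h s - h (s + 1) : ℕ)) (s t : ℕ) :
    (∏ r ∈ Finset.Ico s t, diagEntry h N r).Monic :=
  monic_prod_of_monic _ _ fun r _ => monic_diagEntry (hN r)

/-- There is no condition on `N` besides the degree bounds. For `s < t`, the `s`-th relation is the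
recursion for the cofactors multiplied by `∏_{s ≤ r < t} p_r`. -/
theorem isCanonical_syzFamily [Nontrivial A] {h : ℕ → ℕ} (hh : Antitone h) {t : ℕ} (ht : h t = 0)
    {N : ℕ → ℕ → A[X]}
    (hN : ∀ s l, l ≤ s + 1 → (N s l).degree < (h s - h (s + 1) : ℕ)) :
    IsCanonical h (syzFamily h t N) N where
  adapted :=
    { natDegree_le := fun s => (natDegree_smul_le _ _).trans (natDegree_cofactor_le h N s)
      monic := fun s => by
        rw [syzFamily, coeff_smul, coeff_cofactor_self, smul_eq_mul, mul_one]
        exact monic_prod_diagEntry (fun s => hN s _ le_rfl) s t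
      natDegree_coeff := fun s => by
        rw [syzFamily, coeff_smul, coeff_cofactor_self, smul_eq_mul, mul_one,
          natDegree_prod_of_monic _ _ fun r _ => monic_diagEntry (hN r _ le_rfl),
          Finset.sum_congr rfl fun r _ => natDegree_diagEntry (hN r _ le_rfl)]
        rcases le_total s t with hst | hst
        · rw [sum_Ico_sub_of_antitone hh hst, ht, Nat.sub_zero]
        · rw [Finset.Ico_eq_empty_of_le hst, Finset.sum_empty]
          exact (Nat.le_zero.1 ((hh hst).trans_eq ht)).symm }
  degree_lt := hN
  rel s := by
    rcases lt_or_ge s t with hst | hst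
    · have h1 : syzFamily h t N s =
          (∏ r ∈ Finset.Ico (s + 1) t, diagEntry h N r) • diagEntry h N s • cofactor h N s := by
        rw [syzFamily, ← Finset.prod_Ico_consecutive _ s.le_succ hst, Nat.Ico_succ_singleton,
          Finset.prod_singleton, mul_comm, mul_smul]
      have h2 : ∑ l ∈ Finset.range (s + 1), N s l • syzFamily h t N l =
          (∏ r ∈ Finset.Ico (s + 1) t, diagEntry h N r) • diagEntry h N s •
            ∑ l ∈ Finset.range (s + 1),
              (N s l * ∏ r ∈ Finset.Ico l s, diagEntry h N r) • cofactor h N l := by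
        rw [Finset.smul_sum, Finset.smul_sum]
        refine Finset.sum_congr rfl fun l hl => ?_
        have hl' : l ≤ s := Nat.lt_succ_iff.1 (Finset.mem_range.1 hl)
        rw [syzFamily, ← Finset.prod_Ico_consecutive _ (hl'.trans s.le_succ) hst,
          Finset.prod_Ico_succ_top hl', smul_smul, smul_smul, smul_smul]
        congr 1
        ring
      rw [h1, h2, syzFamily, cofactor_succ]
      simp only [smul_eq_C_mul]
      ring
    -- Beyond `t` the degree bound is `0`, so all entries vanish and the relation reads `x F_s =
    -- F_{s+1}`.
    · have hd : h s - h (s + 1) = 0 := by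
        have := hh hst
        omega
      have hz : ∀ l, l ≤ s + 1 → N s l = 0 := fun l hl => by
        have := hN s l hl
        rw [hd, Nat.cast_zero] at this
        exact degree_eq_bot.1 (by simpa [Nat.WithBot.lt_zero_iff] using this)
      have hz' : ∑ l ∈ Finset.range (s + 1),
          (N s l * ∏ r ∈ Finset.Ico l s, diagEntry h N r) • cofactor h N l = 0 :=
        Finset.sum_eq_zero fun l hl => by
          rw [hz l (Finset.mem_range.1 hl).le, zero_mul, zero_smul]
      rw [Finset.sum_eq_zero fun l hl => by rw [hz l (Finset.mem_range.1 hl).le, zero_smul],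
        diagEntry, hd, hz _ le_rfl, syzFamily, syzFamily, Finset.Ico_eq_empty_of_le hst,
        Finset.Ico_eq_empty_of_le (hst.trans s.le_succ), cofactor_succ, hz']
      simp

namespace IsCanonical

variable {h : ℕ → ℕ} {F : ℕ → A[X][X]} {N : ℕ → ℕ → A[X]}

/-- Solving the triangular system of relations for `F s` in terms of `F 0`, with denominators
cleared by the diagonal entries. -/
theorem prod_smul_eq (H : IsCanonical h F N) (s : ℕ) :
    (∏ r ∈ Finset.Ico 0 s, diagEntry h N r) • F s = F 0 * cofactor h N s := by
  induction s using Nat.strong_induction_on with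
  | _ s ih =>
    cases s with
    | zero => simp [cofactor_zero]
    | succ s =>
      have h1 : diagEntry h N s • F (s + 1) =
          X * F s - ∑ l ∈ Finset.range (s + 1), N s l • F l := by rw [H.rel s]; ring
      rw [Finset.prod_Ico_succ_top (Nat.zero_le s), mul_smul, h1, cofactor_succ, smul_sub,
        mul_sub, ← mul_smul_comm, ih s s.lt_succ_self, Finset.smul_sum, Finset.mul_sum]
      refine congrArg₂ (· - ·) (mul_left_comm _ _ _) ?_
      refine Finset.sum_congr rfl fun l hl => ?_
      have hl' : l ≤ s := Nat.lt_succ_iff.1 (Finset.mem_range.1 hl)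
      rw [mul_smul_comm, ← ih l (Finset.mem_range.1 hl),
        ← Finset.prod_Ico_consecutive _ (Nat.zero_le l) hl', smul_smul, smul_smul]
      congr 1
      ring

/-- A canonical family is determined by its syzygies. -/
theorem eq_syzFamily [IsDomain A] (H : IsCanonical h F N) (hh : Antitone h) {t : ℕ}
    (ht : h t = 0) : F = syzFamily h t N := by
  have hmon := monic_prod_diagEntry (fun s => H.degree_lt s _ le_rfl)
  have hF0 : F 0 = C ((F 0).coeff 0) :=
    eq_C_of_natDegree_eq_zero (Nat.le_zero.1 (H.adapted.natDegree_le 0))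
  -- A monic polynomial of degree `h t = 0`. Comparing coefficients of `x^t` at index `t` then
  -- determines `F 0`, and the remaining members follow by cancelling monic factors.
  have hFt : (F t).coeff t = 1 :=
    (H.adapted.monic t).natDegree_eq_zero.1 (by rw [H.adapted.natDegree_coeff, ht])
  have hc : (F 0).coeff 0 = ∏ r ∈ Finset.Ico 0 t, diagEntry h N r := by
    have := congrArg (fun f => coeff f t) (H.prod_smul_eq t)
    simp only [coeff_smul, hFt, smul_eq_mul, mul_one] at this
    rw [this, hF0, coeff_C_mul, coeff_cofactor_self, mul_one, coeff_C_zero]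
  funext s
  rcases le_total s t with hst | hst
  · have h1 := H.prod_smul_eq s
    rw [hF0, hc, ← smul_eq_C_mul, ← Finset.prod_Ico_consecutive _ (Nat.zero_le s) hst,
      mul_smul] at h1
    exact smul_right_injective _ (hmon 0 s).ne_zero h1
  · have h1 := H.prod_smul_eq s
    have h2 : ∏ r ∈ Finset.Ico t s, diagEntry h N r = 1 := by
      refine (hmon t s).natDegree_eq_zero.1 ?_
      rw [natDegree_prod_of_monic _ _ fun r _ => monic_diagEntry (H.degree_lt r _ le_rfl),
          Finset.sum_congr rfl fun r _ => natDegree_diagEntry (H.degree_lt r _ le_rfl),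
          sum_Ico_sub_of_antitone hh hst, ht, Nat.zero_sub]
    rw [hF0, hc, ← smul_eq_C_mul, ← Finset.prod_Ico_consecutive _ (Nat.zero_le t) hst, h2,
      mul_one] at h1
    rw [syzFamily, Finset.Ico_eq_empty_of_le hst, Finset.prod_empty, one_smul]
    exact smul_right_injective _ (hmon 0 t).ne_zero h1

theorem X_mul_mem_span (H : IsCanonical h F N) {f : A[X][X]}
    (hf : f ∈ Submodule.span A[X] (Set.range F)) :
    X * f ∈ Submodule.span A[X] (Set.range F) := by
  have hF : ∀ s, F s ∈ Submodule.span A[X] (Set.range F) := fun s =>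
    Submodule.subset_span (Set.mem_range_self s)
  induction hf using Submodule.span_induction with
  | mem f hf =>
    obtain ⟨s, rfl⟩ := hf
    rw [H.rel s]
    exact Submodule.add_mem _ (Submodule.sum_mem _ fun l _ => Submodule.smul_mem _ _ (hF l))
      (Submodule.smul_mem _ _ (hF _))
  | zero => rw [mul_zero]; exact Submodule.zero_mem _
  | add f g _ _ hf hg => rw [mul_add]; exact Submodule.add_mem _ hf hg
  | smul c f _ hf => rw [mul_smul_comm]; exact Submodule.smul_mem _ _ hf

/-- The relations make the `A[y]`-span of `F` stable under multiplication by `x`, so this span is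
already the ideal. -/
theorem mem_submodule_span (H : IsCanonical h F N) {f : A[X][X]}
    (hf : f ∈ Ideal.span (Set.range F)) : f ∈ Submodule.span A[X] (Set.range F) := by
  induction hf using Submodule.span_induction with
  | mem f hf => exact Submodule.subset_span hf
  | zero => exact Submodule.zero_mem _
  | add f g _ _ hf hg => exact Submodule.add_mem _ hf hg
  | smul c f _ hf =>
    rw [smul_eq_mul]
    induction c using Polynomial.induction_on' with
    | add c c' hc hc' => rw [add_mul]; exact Submodule.add_mem _ hc hc'
    | monomial n c =>
      induction n with
      | zero =>
        rw [monomial_zero_left, ← smul_eq_C_mul]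
        exact Submodule.smul_mem _ _ hf
      | succ n ih =>
        rw [← X_mul_monomial, mul_assoc]
        exact H.X_mul_mem_span ih

/-- A reduced element of the ideal is an `A[y]`-combination of `F`, so uniqueness of division makes
it zero. -/
theorem noReduced_span [Nontrivial A] (H : IsCanonical h F N) :
    NoReduced h (Ideal.span (Set.range F)) := by
  intro r hr hred
  have hr' := H.mem_submodule_span hr
  rw [Finsupp.mem_span_range_iff_exists_finsupp] at hr'
  obtain ⟨c, hc⟩ := hr'
  obtain ⟨n, hn⟩ := c.support.exists_nat_subset_range
  rw [Finsupp.sum_of_support_subset c hn _ (fun i _ => by rw [zero_smul])] at hc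
  exact neg_eq_zero.1 (H.adapted.eq_zero_of_sum_add_eq_zero c hred.neg n
    (by rw [hc, add_neg_cancel])).2

theorem mem_span (s : ℕ) : F s ∈ Ideal.span (Set.range F) :=
  Ideal.subset_span (Set.mem_range_self s)

/-- An element of the ideal satisfying the same kind of relation as `F (s + 1)` is `F (s + 1)`. -/
theorem succ_unique [IsDomain A] (H : IsCanonical h F N) {s : ℕ} {g : A[X][X]}
    {p : A[X]} {M : ℕ → A[X]}
    (hg : g ∈ Ideal.span (Set.range F)) (hdeg : g.natDegree ≤ s + 1)
    (hlc : (g.coeff (s + 1)).Monic) (hnat : (g.coeff (s + 1)).natDegree = h (s + 1))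
    (hp : p.Monic) (hpd : p.natDegree = h s - h (s + 1))
    (hM : ∀ l ≤ s, (M l).degree < (h s - h (s + 1) : ℕ))
    (hrel : X * F s = ∑ l ∈ Finset.range (s + 1), M l • F l + p • g) :
    g = F (s + 1) ∧ p = diagEntry h N s ∧ ∀ l ≤ s, M l = N s l := by
  obtain ⟨q, hq⟩ := H.noReduced_span.exists_eq_sum H.adapted mem_span hg
    (n := s + 2) (fun a ha => coeff_eq_zero_of_natDegree_lt (by omega))
  have hlc' : g.coeff (s + 1) = q (s + 1) * (F (s + 1)).coeff (s + 1) := by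
    conv_lhs => rw [hq]
    exact H.adapted.coeff_sum q (s + 1)
  -- The `x^(s+1)`-coefficients of `g` and `F (s + 1)` are monic of equal degree, so their quotient
  -- is monic of degree zero.
  have hq1 : q (s + 1) = 1 := by
    rw [hlc'] at hlc hnat
    have hqm := Monic.of_mul_monic_right (H.adapted.monic (s + 1)) hlc
    rw [hqm.natDegree_mul (H.adapted.monic _), H.adapted.natDegree_coeff] at hnat
    exact hqm.natDegree_eq_zero.1 (by omega)
  rw [Finset.sum_range_succ, hq1, one_smul] at hq
  -- The two relations for `x F_s` are subtracted after substituting the expansion of `g`;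
  -- independence of `F` makes every coefficient vanish.
  have key := H.adapted.eq_zero_of_sum_eq_zero
    (fun l => if l = s + 1 then p - diagEntry h N s else M l - N s l + p * q l) (s + 2) (by
      rw [Finset.sum_range_succ, if_pos rfl, Finset.sum_congr rfl fun l hl => by
        rw [if_neg (Finset.mem_range.1 hl).ne]]
      have h1 := hrel.symm.trans (H.rel s)
      rw [hq, smul_add, Finset.smul_sum] at h1
      simp only [add_smul, sub_smul, mul_smul, Finset.sum_add_distrib, Finset.sum_sub_distrib]
      linear_combination h1)
  have hpe : p = diagEntry h N s := by
    have := key (s + 1) (by omega)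
    rw [if_pos rfl] at this
    exact sub_eq_zero.1 this
  have hql : ∀ l ≤ s, q l = 0 ∧ M l = N s l := fun l hl => by
    have h1 := key l (by omega)
    rw [if_neg (by omega)] at h1
    -- Here `p * q l = N s l - M l` has degree below that of the monic `p`.
    have h2 : q l = 0 := by
      by_contra hne
      have h3 : (p * q l).degree < (h s - h (s + 1) : ℕ) := by
        rw [show p * q l = N s l - M l by linear_combination h1]
        exact (degree_sub_le _ _).trans_lt (max_lt (H.degree_lt s l (by omega)) (hM l hl))
      rw [mul_comm, hp.degree_mul, degree_eq_natDegree hp.ne_zero, hpd, degree_eq_natDegree hne,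
        ← Nat.cast_add, Nat.cast_lt] at h3
      omega
    refine ⟨h2, ?_⟩
    rw [h2, mul_zero, add_zero] at h1
    exact sub_eq_zero.1 h1
  refine ⟨?_, hpe, fun l hl => (hql l hl).2⟩
  rw [hq, Finset.sum_eq_zero fun l hl => ?_, zero_add]
  rw [(hql l (Nat.lt_succ_iff.1 (Finset.mem_range.1 hl))).1, zero_smul]

/-- An element of the ideal which is reduced like `F 0` is `F 0`. -/
theorem zero_unique [Nontrivial A] (H : IsCanonical h F N) {g : A[X][X]}
    (hg : g ∈ Ideal.span (Set.range F)) (hdeg : g.natDegree ≤ 0)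
    (hlc : (g.coeff 0).Monic) (hnat : (g.coeff 0).natDegree = h 0) : g = F 0 := by
  -- Both constant coefficients are monic of degree `h 0`, so the difference is reduced.
  refine sub_eq_zero.1 (H.noReduced_span _ (Ideal.sub_mem _ hg (mem_span 0)) fun s => ?_)
  rcases Nat.eq_zero_or_pos s with rfl | hs
  · rw [coeff_sub]
    refine (degree_sub_lt_left ?_ hlc.ne_zero ?_).trans_eq ?_
    · rw [H.adapted.degree_coeff, degree_eq_natDegree hlc.ne_zero, hnat]
    · rw [hlc.leadingCoeff, (H.adapted.monic 0).leadingCoeff]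
    · rw [degree_eq_natDegree hlc.ne_zero, hnat]
  · rw [coeff_sub, H.adapted.coeff_eq_zero hs, coeff_eq_zero_of_natDegree_lt (by omega), sub_zero,
      degree_zero]
    exact WithBot.bot_lt_coe _

/-- An ideal contains at most one canonical family. -/
theorem unique [IsDomain A] (H : IsCanonical h F N) {F' : ℕ → A[X][X]} {N' : ℕ → ℕ → A[X]}
    (H' : IsCanonical h F' N') (hF' : ∀ s, F' s ∈ Ideal.span (Set.range F)) :
    ∀ s l, l ≤ s + 1 → N' s l = N s l := by
  have key : ∀ s, (∀ l ≤ s, F' l = F l) → F' (s + 1) = F (s + 1) ∧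
      diagEntry h N' s = diagEntry h N s ∧ ∀ l ≤ s, N' s l = N s l := fun s hs =>
    H.succ_unique (hF' _) (H'.adapted.natDegree_le _) (H'.adapted.monic _)
      (H'.adapted.natDegree_coeff _) (monic_diagEntry (H'.degree_lt s _ le_rfl))
      (natDegree_diagEntry (H'.degree_lt s _ le_rfl)) (fun l hl => H'.degree_lt s l (by omega)) (by
        rw [← hs s le_rfl, H'.rel s]
        congr 1
        exact Finset.sum_congr rfl fun l hl => by
          rw [hs l (Nat.lt_succ_iff.1 (Finset.mem_range.1 hl))])
  have hFF : ∀ s, F' s = F s := fun s => by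
    induction s using Nat.strong_induction_on with
    | _ s ih =>
      cases s with
      | zero =>
        exact H.zero_unique (hF' 0) (H'.adapted.natDegree_le 0) (H'.adapted.monic 0)
          (H'.adapted.natDegree_coeff 0)
      | succ s => exact (key s fun l hl => ih l (Nat.lt_succ_iff.2 hl)).1
  intro s l hl
  obtain ⟨-, h2, h3⟩ := key s fun l _ => hFF l
  rcases Nat.lt_succ_iff_lt_or_eq.1 (Nat.lt_succ_iff.2 hl) with hl | rfl
  · exact h3 l (by omega)
  · exact add_left_cancel h2

end IsCanonical

end Canonical

/-! ### Reducing an arbitrary adapted family to canonical form. -/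

section Algorithm

open Polynomial

variable {A : Type*} [CommRing A]

/-- The quotients of `x * H s` by `H 0, …, H (s + 1)`. -/
noncomputable def syzQuot (h : ℕ → ℕ) (H : ℕ → A[X][X]) (s : ℕ) : ℕ → A[X] :=
  (division h H (s + 2) (X * H s)).1

/-- Replace `H (s + 1)` such that the `s`-th syzygy becomes reduced. -/
noncomputable def canonStep (h : ℕ → ℕ) (H : ℕ → A[X][X]) (s : ℕ) : ℕ → A[X][X] :=
  Function.update H (s + 1) (H (s + 1) + ∑ l ∈ Finset.range (s + 1),
    (syzQuot h H s l /ₘ syzQuot h H s (s + 1)) • H l)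

/-- The adapted family `G` after the first `s` reduction steps. -/
noncomputable def canonState (h : ℕ → ℕ) (G : ℕ → A[X][X]) : ℕ → ℕ → A[X][X]
  | 0 => G
  | s + 1 => canonStep h (canonState h G s) s

/-- The result of the reduction of the syzygies of `G`. -/
noncomputable def canonFamily (h : ℕ → ℕ) (G : ℕ → A[X][X]) (s : ℕ) : A[X][X] :=
  canonState h G s s

/-- The reduced syzygies. -/
noncomputable def canonData (h : ℕ → ℕ) (G : ℕ → A[X][X]) (s l : ℕ) : A[X] :=
  if l = s + 1 then syzQuot h (canonState h G s) s (s + 1) - X ^ (h s - h (s + 1))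
  else syzQuot h (canonState h G s) s l %ₘ syzQuot h (canonState h G s) s (s + 1)

variable {h : ℕ → ℕ}

theorem IsAdapted.coeff_X_mul_eq_zero {H : ℕ → A[X][X]} (hH : IsAdapted h H) (s : ℕ) :
    ∀ a, s + 2 ≤ a → (X * H s).coeff a = 0 := by
  rintro (_ | a) ha
  · omega
  · rw [coeff_X_mul, hH.coeff_eq_zero (by omega)]

section Nontrivial

variable [Nontrivial A]

theorem IsAdapted.isDivision_syzQuot {H : ℕ → A[X][X]} (hH : IsAdapted h H) (s : ℕ) :
    IsDivision h H (s + 2) (X * H s) (syzQuot h H s) (division h H (s + 2) (X * H s)).2 :=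
  hH.isDivision (hH.coeff_X_mul_eq_zero s)

/-- In the coefficient of `x^(s+1)` in the division of `x * H s`, the remainder has degree below `h
(s+1) ≤ h s` and cannot disturb the leading term. The diagonal quotient is thus monic over any ring,
and one may divide by it. -/
theorem IsAdapted.syzQuot_succ (hh : Antitone h) {H : ℕ → A[X][X]} (hH : IsAdapted h H) (s : ℕ) :
    (syzQuot h H s (s + 1)).Monic ∧
      (syzQuot h H s (s + 1)).natDegree = h s - h (s + 1) := by
  have hd := hH.isDivision_syzQuot s
  set r := (division h H (s + 2) (X * H s)).2
  have hs := hh s.le_succ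
  have hlt : (r.coeff (s + 1)).degree < ((H s).coeff s).degree := by
    rw [hH.degree_coeff]
    exact (hd.reduced (s + 1)).trans_le (Nat.cast_le.2 hs)
  have h1 : syzQuot h H s (s + 1) * (H (s + 1)).coeff (s + 1) =
      (H s).coeff s - r.coeff (s + 1) := by
    have := congrArg (fun f => coeff f (s + 1)) hd.eq
    simp only [coeff_X_mul, coeff_add, hH.coeff_sum] at this
    rw [this, add_sub_cancel_right]
  have h2 : (syzQuot h H s (s + 1) * (H (s + 1)).coeff (s + 1)).Monic := by
    rw [h1]; exact (hH.monic s).sub_of_left hlt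
  have h3 := Monic.of_mul_monic_right (hH.monic (s + 1)) h2
  refine ⟨h3, ?_⟩
  have h4 : (syzQuot h H s (s + 1) * (H (s + 1)).coeff (s + 1)).natDegree = h s := by
    rw [h1, natDegree_eq_of_degree_eq (degree_sub_eq_left_of_degree_lt hlt), hH.natDegree_coeff]
  rw [h3.natDegree_mul (hH.monic _), hH.natDegree_coeff] at h4
  omega

end Nontrivial

end Algorithm

end GroebnerCell

namespace GroebnerCell

section Algorithm

open Polynomial

variable {A : Type*} [CommRing A] {h : ℕ → ℕ}

theorem canonStep_of_ne {H : ℕ → A[X][X]} {s l : ℕ} (hl : l ≠ s + 1) :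
    canonStep h H s l = H l := Function.update_of_ne hl _ _

/-- Step `n` alters only the member with index `n + 1`, so member `l` is final once `l` steps are
done. -/
theorem canonState_of_le {G : ℕ → A[X][X]} {n l : ℕ} (hl : l ≤ n) :
    canonState h G n l = canonFamily h G l := by
  induction n, hl using Nat.le_induction with
  | base => rfl
  | succ n hn ih => rw [canonState, canonStep_of_ne (by omega), ih]

theorem canonState_mem {I : Ideal A[X][X]} {G : ℕ → A[X][X]} (hG : ∀ s, G s ∈ I) (n : ℕ) :
    ∀ s, canonState h G n s ∈ I := by
  induction n with
  | zero => exact hG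
  | succ n ih =>
    intro s
    rw [canonState, canonStep]
    rcases eq_or_ne s (n + 1) with rfl | hs
    · rw [Function.update_self]
      exact I.add_mem (ih _) (sum_smul_mem_ideal ih _ _)
    · rw [Function.update_of_ne hs]
      exact ih s

theorem IsAdapted.canonStep {H : ℕ → A[X][X]} (hH : IsAdapted h H) (s : ℕ) :
    IsAdapted h (canonStep h H s) := by
  have hc : ∀ a, s + 1 ≤ a → (GroebnerCell.canonStep h H s (s + 1)).coeff a =
      (H (s + 1)).coeff a := fun a ha => by
    rw [GroebnerCell.canonStep, Function.update_self, coeff_add, hH.coeff_sum_eq_zero _ ha,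
      add_zero]
  refine ⟨fun a => ?_, fun a => ?_, fun a => ?_⟩ <;> rcases eq_or_ne a (s + 1) with rfl | ha
  · refine natDegree_le_iff_coeff_eq_zero.2 fun a ha => ?_
    rw [hc a ha.le, hH.coeff_eq_zero ha]
  · rw [canonStep_of_ne ha]; exact hH.natDegree_le a
  · rw [hc _ le_rfl]; exact hH.monic _
  · rw [canonStep_of_ne ha]; exact hH.monic a
  · rw [hc _ le_rfl]; exact hH.natDegree_coeff _
  · rw [canonStep_of_ne ha]; exact hH.natDegree_coeff a

theorem IsAdapted.canonState {G : ℕ → A[X][X]} (hG : IsAdapted h G) (n : ℕ) :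
    IsAdapted h (canonState h G n) := by
  induction n with
  | zero => exact hG
  | succ n ih => exact ih.canonStep n

theorem IsAdapted.canonFamily {G : ℕ → A[X][X]} (hG : IsAdapted h G) :
    IsAdapted h (canonFamily h G) where
  natDegree_le s := (hG.canonState s).natDegree_le s
  monic s := (hG.canonState s).monic s
  natDegree_coeff s := (hG.canonState s).natDegree_coeff s

section Nontrivial

variable [Nontrivial A]

theorem IsAdapted.degree_canonData_lt (hh : Antitone h) {G : ℕ → A[X][X]} (hG : IsAdapted h G)
    {s l : ℕ} : (canonData h G s l).degree < (h s - h (s + 1) : ℕ) := by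
  obtain ⟨hm, hd⟩ := (hG.canonState s).syzQuot_succ hh s
  have hdeg : (syzQuot h (GroebnerCell.canonState h G s) s (s + 1)).degree =
      (h s - h (s + 1) : ℕ) := by rw [degree_eq_natDegree hm.ne_zero, hd]
  rw [canonData, ← hdeg]
  split_ifs with hl
  · refine degree_sub_lt_left ?_ hm.ne_zero ?_
    · rw [hdeg, degree_X_pow]
    · rw [hm.leadingCoeff, (monic_X_pow _).leadingCoeff]
  · exact degree_modByMonic_lt _ hm

/-- Each quotient is divided by the diagonal one: the remainders are the new entries, and the
quotients are absorbed into the new member `s + 1`. A reduced error `r` is allowed because no ideal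
without reduced elements is given; with indeterminate coefficients it need not vanish. -/
theorem IsAdapted.canonFamily_rel (hh : Antitone h) {G : ℕ → A[X][X]} (hG : IsAdapted h G)
    (s : ℕ) : ∃ r, IsReduced h r ∧ X * GroebnerCell.canonFamily h G s =
      ∑ l ∈ Finset.range (s + 1), canonData h G s l • GroebnerCell.canonFamily h G l +
      diagEntry h (canonData h G) s • GroebnerCell.canonFamily h G (s + 1) + r := by
  have hH := hG.canonState s
  have hdiv := hH.isDivision_syzQuot s
  obtain ⟨hm, -⟩ := hH.syzQuot_succ hh s
  refine ⟨_, hdiv.reduced, ?_⟩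
  have h1 : GroebnerCell.canonFamily h G (s + 1) = GroebnerCell.canonState h G s (s + 1) +
      ∑ l ∈ Finset.range (s + 1), (syzQuot h (GroebnerCell.canonState h G s) s l /ₘ
        syzQuot h (GroebnerCell.canonState h G s) s (s + 1)) •
          GroebnerCell.canonState h G s l := by
    rw [GroebnerCell.canonFamily, GroebnerCell.canonState, GroebnerCell.canonStep,
      Function.update_self]
  have h2 : diagEntry h (canonData h G) s =
      syzQuot h (GroebnerCell.canonState h G s) s (s + 1) := by
    rw [diagEntry, canonData, if_pos rfl]; ring
  have h3 : ∑ l ∈ Finset.range (s + 1), canonData h G s l • GroebnerCell.canonFamily h G l =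
      ∑ l ∈ Finset.range (s + 1), (syzQuot h (GroebnerCell.canonState h G s) s l %ₘ
        syzQuot h (GroebnerCell.canonState h G s) s (s + 1)) •
          GroebnerCell.canonState h G s l := Finset.sum_congr rfl fun l hl => by
    have hl' := Finset.mem_range.1 hl
    rw [canonState_of_le (Nat.lt_succ_iff.1 hl'), canonData, if_neg hl'.ne]
  refine Eq.trans hdiv.eq ?_
  rw [h1, h2, h3, smul_add, Finset.smul_sum, Finset.sum_range_succ]
  have h4 : ∑ l ∈ Finset.range (s + 1), syzQuot h (GroebnerCell.canonState h G s) s l •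
        GroebnerCell.canonState h G s l =
      ∑ l ∈ Finset.range (s + 1), (syzQuot h (GroebnerCell.canonState h G s) s l %ₘ
        syzQuot h (GroebnerCell.canonState h G s) s (s + 1)) •
          GroebnerCell.canonState h G s l +
      ∑ l ∈ Finset.range (s + 1), syzQuot h (GroebnerCell.canonState h G s) s (s + 1) •
        (syzQuot h (GroebnerCell.canonState h G s) s l /ₘ
        syzQuot h (GroebnerCell.canonState h G s) s (s + 1)) •
          GroebnerCell.canonState h G s l := by
    rw [← Finset.sum_add_distrib]
    refine Finset.sum_congr rfl fun l _ => ?_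
    rw [smul_smul, ← add_smul, modByMonic_add_div]
  rw [h4]
  ring

/-- The reduction steps stay inside `I`, so the error in each relation is a reduced element of `I`,
hence zero. -/
theorem IsAdapted.isCanonical (hh : Antitone h) {G : ℕ → A[X][X]} (hG : IsAdapted h G)
    {I : Ideal A[X][X]} (hI : NoReduced h I) (hGI : ∀ s, G s ∈ I) :
    IsCanonical h (GroebnerCell.canonFamily h G) (canonData h G) where
  adapted := hG.canonFamily
  degree_lt _ _ _ := hG.degree_canonData_lt hh
  rel s := by
    have hmem : ∀ s, GroebnerCell.canonFamily h G s ∈ I := fun s => canonState_mem hGI s s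
    obtain ⟨r, hr, heq⟩ := hG.canonFamily_rel hh s
    have : r = 0 := hI r (by
      rw [← sub_eq_iff_eq_add'.2 heq]
      exact I.sub_mem (I.mul_mem_left _ (hmem s))
        (I.add_mem (sum_smul_mem_ideal hmem _ _) (smul_mem_ideal I _ (hmem _)))) hr
    rw [heq, this, add_zero]

section Map

variable {A' : Type*} [CommRing A'] [Nontrivial A'] (φ : A →+* A')

theorem IsAdapted.syzQuot_map {H : ℕ → A[X][X]} (hH : IsAdapted h H) (s l : ℕ) :
    syzQuot h (fun s => (H s).map (mapRingHom φ)) s l = (syzQuot h H s l).map φ := by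
  have := hH.division_map φ (hH.coeff_X_mul_eq_zero s)
  rw [Polynomial.map_mul, map_X] at this
  rw [syzQuot, this, syzQuot]

theorem IsAdapted.canonState_map (hh : Antitone h) {G : ℕ → A[X][X]} (hG : IsAdapted h G) (n : ℕ) :
    GroebnerCell.canonState h (fun s => (G s).map (mapRingHom φ)) n =
      fun s => (GroebnerCell.canonState h G n s).map (mapRingHom φ) := by
  induction n with
  | zero => rfl
  | succ n ih =>
    have hH := hG.canonState n
    obtain ⟨hm, -⟩ := hH.syzQuot_succ hh n
    funext s
    rw [GroebnerCell.canonState, GroebnerCell.canonState, ih]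
    rcases eq_or_ne s (n + 1) with rfl | hs
    · rw [GroebnerCell.canonStep, GroebnerCell.canonStep, Function.update_self,
        Function.update_self, Polynomial.map_add, Polynomial.map_sum]
      congr 1
      refine Finset.sum_congr rfl fun l _ => ?_
      rw [smul_map, hH.syzQuot_map, hH.syzQuot_map, map_divByMonic φ hm]
    · rw [canonStep_of_ne hs, canonStep_of_ne hs]

theorem IsAdapted.canonData_map (hh : Antitone h) {G : ℕ → A[X][X]} (hG : IsAdapted h G)
    (s l : ℕ) : canonData h (fun s => (G s).map (mapRingHom φ)) s l =
      (canonData h G s l).map φ := by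
  have hH := hG.canonState s
  obtain ⟨hm, -⟩ := hH.syzQuot_succ hh s
  rw [canonData, canonData, hG.canonState_map φ hh]
  simp only [hH.syzQuot_map φ]
  split_ifs
  · rw [Polynomial.map_sub, Polynomial.map_pow, map_X]
  · rw [map_modByMonic φ hm]

end Map

end Nontrivial

end Algorithm

/-! ### The reduced Gröbner basis: normal forms of the corners. -/

section ReducedBasis

open Polynomial

variable {A : Type*} [CommRing A] {h : ℕ → ℕ}

/-- The monomial `x ^ s * y ^ h s`. -/
noncomputable def corner (h : ℕ → ℕ) (s : ℕ) : A[X][X] := monomial s (X ^ h s)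

theorem corner_map {A' : Type*} [CommRing A'] (φ : A →+* A') (h : ℕ → ℕ) (s : ℕ) :
    (corner h s : A[X][X]).map (mapRingHom φ) = corner h s := by
  simp [corner]

theorem coeff_corner_eq_zero (h : ℕ → ℕ) (s : ℕ) :
    ∀ a, s + 1 ≤ a → (corner h s : A[X][X]).coeff a = 0 := fun a ha => by
  rw [corner, coeff_monomial, if_neg (by omega)]

/-- The normal form of `x ^ s * y ^ h s` modulo the family `F`. -/
noncomputable def cornerTail (h : ℕ → ℕ) (F : ℕ → A[X][X]) (s : ℕ) : A[X][X] :=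
  (division h F (s + 1) (corner h s)).2

/-- The first place at which `h` takes the value `h s`. -/
noncomputable def base (h : ℕ → ℕ) (s : ℕ) : ℕ := sInf {l | h l = h s}

theorem apply_base (h : ℕ → ℕ) (s : ℕ) : h (base h s) = h s :=
  Nat.sInf_mem (s := {l | h l = h s}) ⟨s, rfl⟩

theorem base_le (h : ℕ → ℕ) {s l : ℕ} (hl : h l = h s) : base h s ≤ l :=
  Nat.sInf_le (s := {l | h l = h s}) hl

theorem base_base (h : ℕ → ℕ) (s : ℕ) : base h (base h s) = base h s := by
  change sInf {l | h l = h (base h s)} = _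
  rw [apply_base h s]
  rfl

/-- The adapted family of the polynomials `x ^ s * y ^ h s - r s`, where only the corners of
the staircase `h` are used. -/
noncomputable def stairFamily (h : ℕ → ℕ) (r : ℕ → A[X][X]) (s : ℕ) : A[X][X] :=
  X ^ (s - base h s) * (corner h (base h s) - r (base h s))

theorem stairFamily_map {A' : Type*} [CommRing A'] (φ : A →+* A') (h : ℕ → ℕ)
    (r : ℕ → A[X][X]) (s : ℕ) : (stairFamily h r s).map (mapRingHom φ) =
      stairFamily h (fun s => (r s).map (mapRingHom φ)) s := by
  rw [stairFamily, Polynomial.map_mul, Polynomial.map_pow, map_X, Polynomial.map_sub, corner_map,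
    stairFamily]

theorem isAdapted_stairFamily [Nontrivial A] {r : ℕ → A[X][X]}
    (hr : ∀ s, base h s = s → IsReduced h (r s) ∧ ∀ a, s + 1 ≤ a → (r s).coeff a = 0) :
    IsAdapted h (stairFamily h r) := by
  have hc : ∀ s, (stairFamily h r s).coeff s = X ^ h s - (r (base h s)).coeff (base h s) :=
    fun s => by
      have hX := coeff_X_pow_mul (corner h (base h s) - r (base h s)) (s - base h s) (base h s)
      rw [Nat.add_sub_cancel' (base_le h rfl)] at hX
      rw [stairFamily, hX, coeff_sub, corner, coeff_monomial, if_pos rfl, apply_base h s]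
  have hlt : ∀ s, ((r (base h s)).coeff (base h s)).degree < (X ^ h s : A[X]).degree :=
    fun s => by
      rw [degree_X_pow, ← apply_base h s]
      exact (hr _ (base_base h s)).1 _
  refine ⟨fun s => ?_, fun s => ?_, fun s => ?_⟩
  · refine natDegree_le_iff_coeff_eq_zero.2 fun a ha => ?_
    have hs := base_le h (l := s) rfl
    obtain ⟨b, rfl⟩ : ∃ b, a = b + (s - base h s) := ⟨a - (s - base h s), by omega⟩
    rw [stairFamily, coeff_X_pow_mul, coeff_sub, coeff_corner_eq_zero _ _ _ (by omega),
      (hr _ (base_base h s)).2 b (by omega), sub_zero]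
  · rw [hc]
    exact (monic_X_pow _).sub_of_left (hlt s)
  · rw [hc, natDegree_eq_of_degree_eq (degree_sub_eq_left_of_degree_lt (hlt s)), natDegree_X_pow]

theorem stairFamily_mem {I : Ideal A[X][X]} {r : ℕ → A[X][X]}
    (hr : ∀ s, base h s = s → corner h s - r s ∈ I) (s : ℕ) : stairFamily h r s ∈ I :=
  I.mul_mem_left _ (hr _ (base_base h s))

theorem IsAdapted.isDivision_cornerTail [Nontrivial A] {F : ℕ → A[X][X]} (hF : IsAdapted h F)
    (s : ℕ) : IsDivision h F (s + 1) (corner h s) (division h F (s + 1) (corner h s)).1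
      (cornerTail h F s) :=
  hF.isDivision (coeff_corner_eq_zero h s)

theorem IsAdapted.corner_sub_mem [Nontrivial A] {F : ℕ → A[X][X]} (hF : IsAdapted h F)
    {I : Ideal A[X][X]} (hFI : ∀ s, F s ∈ I) (s : ℕ) : corner h s - cornerTail h F s ∈ I := by
  rw [sub_eq_of_eq_add (hF.isDivision_cornerTail s).eq]
  exact sum_smul_mem_ideal hFI _ _

theorem IsAdapted.cornerTail_map [Nontrivial A] {A' : Type*} [CommRing A'] [Nontrivial A']
    (φ : A →+* A') {F : ℕ → A[X][X]} (hF : IsAdapted h F) (s : ℕ) :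
    cornerTail h (fun s => (F s).map (mapRingHom φ)) s =
      (cornerTail h F s).map (mapRingHom φ) := by
  have := hF.division_map φ (coeff_corner_eq_zero h s)
  rw [corner_map] at this
  rw [cornerTail, this, cornerTail]

end ReducedBasis

end GroebnerCell

namespace GroebnerCell

/-! ### The conditions `y ∈ √I` and `x ∈ √I` in terms of the syzygy matrix. -/

section Radical

open Polynomial

theorem eq_X_pow_of_monic_of_dvd {K : Type*} [Field K] {f : K[X]} (hf : f.Monic) {n : ℕ}
    (hd : f ∣ X ^ n) : f = X ^ f.natDegree := by
  obtain ⟨i, -, hi⟩ := (dvd_prime_pow prime_X n).1 hd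
  have h1 := eq_of_monic_of_associated hf (monic_X_pow i) hi
  rw [h1, natDegree_X_pow]

variable {K : Type*} [Field K] {h : ℕ → ℕ} {F : ℕ → K[X][X]} {N : ℕ → ℕ → K[X]} {t : ℕ}

namespace IsCanonical

theorem eq_zero_of_eq (H : IsCanonical h F N) {s l : ℕ} (hs : h s ≤ h (s + 1)) (hl : l ≤ s + 1) :
    N s l = 0 := by
  have h1 := H.degree_lt s l hl
  rw [Nat.sub_eq_zero_of_le hs, Nat.cast_zero] at h1
  exact degree_eq_bot.1 (by simpa [Nat.WithBot.lt_zero_iff] using h1)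

theorem coeff_self (H : IsCanonical h F N) (hh : Antitone h) (ht : h t = 0) (s : ℕ) :
    (F s).coeff s = ∏ r ∈ Finset.Ico s t, diagEntry h N r := by
  conv_lhs => rw [H.eq_syzFamily hh ht]
  rw [syzFamily, coeff_smul, coeff_cofactor_self, smul_eq_mul, mul_one]

theorem zero_eq (H : IsCanonical h F N) : F 0 = C ((F 0).coeff 0) :=
  eq_C_of_natDegree_eq_zero (Nat.le_zero.1 (H.adapted.natDegree_le 0))

theorem coeff_self_eq_X_pow (H : IsCanonical h F N) (hh : Antitone h) (ht : h t = 0)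
    (hN : ∀ s, N s (s + 1) = 0) (s : ℕ) : (F s).coeff s = X ^ h s := by
  have h1 := H.coeff_self hh ht s
  simp only [diagEntry, hN, add_zero, Finset.prod_pow_eq_pow_sum] at h1
  have h2 := H.adapted.natDegree_coeff s
  rw [h1, natDegree_X_pow] at h2
  rw [h1, h2]

/-- The elements of `x`-degree zero in the ideal are the multiples of `F 0 = ∏ p_r`. If a power of
`y` is among them, each monic factor `p_r` is itself a power of `y`. -/
theorem C_X_mem_radical_iff (H : IsCanonical h F N) (hh : Antitone h) (ht : h t = 0) :
    C X ∈ (Ideal.span (Set.range F)).radical ↔ ∀ s, N s (s + 1) = 0 := by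
  constructor
  · rintro ⟨n, hn⟩ s
    rcases lt_or_ge s t with hst | hst
    · obtain ⟨q, hq⟩ := H.noReduced_span.exists_eq_sum H.adapted mem_span hn (n := 1)
        (fun a ha => by rw [← C_pow, coeff_C, if_neg (by omega)])
      rw [Finset.sum_range_one, H.zero_eq, smul_eq_C_mul, ← C_pow, ← C_mul, C_inj,
        H.coeff_self hh ht] at hq
      have hd : diagEntry h N s ∣ X ^ n := by
        rw [hq]
        exact (Finset.dvd_prod_of_mem _ (Finset.mem_Ico.2 ⟨s.zero_le, hst⟩)).mul_left _
      have h1 := eq_X_pow_of_monic_of_dvd (monic_diagEntry (H.degree_lt s _ le_rfl)) hd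
      rw [natDegree_diagEntry (H.degree_lt s _ le_rfl), diagEntry] at h1
      exact left_eq_add.1 h1.symm
    · have := hh hst
      exact H.eq_zero_of_eq (by omega) le_rfl
  · intro hN
    refine ⟨h 0, ?_⟩
    rw [← C_pow, ← H.coeff_self_eq_X_pow hh ht hN 0, ← H.zero_eq]
    exact mem_span 0

end IsCanonical

theorem cofactor_succ_of_eq (H : IsCanonical h F N) {s : ℕ} (hs : h s ≤ h (s + 1)) :
    cofactor h N (s + 1) = X * cofactor h N s := by
  rw [cofactor_succ, Finset.sum_eq_zero, sub_zero]
  intro l hl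
  rw [H.eq_zero_of_eq hs (Finset.mem_range.1 hl).le, zero_mul, zero_smul]

/-- While `h` stays constant the degree bound is `0`, so all entries vanish and each step only
multiplies by `x`. -/
theorem cofactor_eq_X_pow_mul (hh : Antitone h) (H : IsCanonical h F N) {a l : ℕ} (hal : a ≤ l)
    (hl : h a = h l) : cofactor h N l = X ^ (l - a) * cofactor h N a := by
  induction l, hal using Nat.le_induction with
  | base => simp
  | succ l hal ih =>
    have h1 := hh hal
    have h2 := hh (Nat.le_add_right l 1)
    rw [cofactor_succ_of_eq H (by omega), ih (by omega), Nat.sub_add_comm hal, pow_succ']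
    ring

/-- The cofactors modulo `y`. -/
noncomputable def cofactorMod (h : ℕ → ℕ) (N : ℕ → ℕ → K[X]) (s : ℕ) : K[X] :=
  (cofactor h N s).map constantCoeff

theorem monic_cofactorMod (h : ℕ → ℕ) (N : ℕ → ℕ → K[X]) (s : ℕ) :
    (cofactorMod h N s).Monic ∧ (cofactorMod h N s).natDegree = s := by
  have h1 : (cofactorMod h N s).natDegree ≤ s :=
    natDegree_map_le.trans (natDegree_cofactor_le h N s)
  have h2 : (cofactorMod h N s).coeff s = 1 := by
    rw [cofactorMod, coeff_map, coeff_cofactor_self, map_one]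
  exact ⟨monic_of_natDegree_le_of_coeff_eq_one s h1 h2,
    natDegree_eq_of_le_of_coeff_ne_zero h1 (by rw [h2]; exact one_ne_zero)⟩

theorem constantCoeff_prod_diagEntry (hh : Antitone h) (hN : ∀ s, N s (s + 1) = 0) {l s : ℕ}
    (hl : l ≤ s) : constantCoeff (∏ r ∈ Finset.Ico l s, diagEntry h N r) =
      if h l = h s then 1 else 0 := by
  simp only [diagEntry, hN, add_zero, Finset.prod_pow_eq_pow_sum, sum_Ico_sub_of_antitone hh hl]
  rw [map_pow, constantCoeff_apply, coeff_X_zero, zero_pow_eq]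
  have := hh hl
  exact if_congr (by omega) rfl rfl

/-- With zero `N s (s + 1)` the diagonal product is `y^(h l - h s)`, so modulo `y` only the indices
`l` on the plateau of `s` survive. -/
theorem cofactorMod_succ (hh : Antitone h) (hN : ∀ s, N s (s + 1) = 0) (s : ℕ) :
    cofactorMod h N (s + 1) = X * cofactorMod h N s - ∑ l ∈ Finset.range (s + 1),
      if h l = h s then C ((N s l).coeff 0) * cofactorMod h N l else 0 := by
  rw [cofactorMod, cofactor_succ, Polynomial.map_sub, Polynomial.map_mul, map_X,
    Polynomial.map_sum]
  refine congrArg₂ (· - ·) rfl (Finset.sum_congr rfl fun l hl => ?_)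
  rw [smul_eq_C_mul, Polynomial.map_mul, map_C, map_mul,
    constantCoeff_prod_diagEntry hh hN (Nat.lt_succ_iff.1 (Finset.mem_range.1 hl)),
    constantCoeff_apply]
  split_ifs
  · rw [mul_one]; rfl
  · rw [mul_zero, C_0, zero_mul]

theorem cofactorMod_eq_X_pow_mul (hh : Antitone h) (H : IsCanonical h F N) {a l : ℕ} (hal : a ≤ l)
    (hl : h a = h l) : cofactorMod h N l = X ^ (l - a) * cofactorMod h N a := by
  rw [cofactorMod, cofactor_eq_X_pow_mul hh H hal hl, Polynomial.map_mul, Polynomial.map_pow,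
    map_X, cofactorMod]

/-- On the plateau of `s` every reduced cofactor is a power of `x` times the one at `base h s`. That
one therefore divides the next cofactor `x^(s+1)` and, being monic, is a power of `x`. The recursion
then says that a combination of the distinct powers `x^l` with coefficients `N_{s,l}(0)` is zero. -/
theorem cofactorMod_descend (hh : Antitone h) (H : IsCanonical h F N) (hN : ∀ s, N s (s + 1) = 0)
    {s : ℕ} (hs : cofactorMod h N (s + 1) = X ^ (s + 1)) :
    cofactorMod h N s = X ^ s ∧ ∀ l ≤ s, h l = h s → (N s l).coeff 0 = 0 := by
  have hblock : ∀ l ≤ s, h l = h s →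
      cofactorMod h N l = X ^ (l - base h s) * cofactorMod h N (base h s) := fun l _ hl =>
    cofactorMod_eq_X_pow_mul hh H (base_le h hl) (by rw [apply_base h s, hl])
  have hdvd : cofactorMod h N (base h s) ∣ X ^ (s + 1) := by
    rw [← hs, cofactorMod_succ hh hN]
    refine dvd_sub ((Dvd.intro_left _ (hblock s le_rfl rfl).symm).mul_left _)
      (Finset.dvd_sum fun l hl => ?_)
    split_ifs with hls
    · exact (Dvd.intro_left _
        (hblock l (Nat.lt_succ_iff.1 (Finset.mem_range.1 hl)) hls).symm).mul_left _
    · exact dvd_zero _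
  have hbase := eq_X_pow_of_monic_of_dvd (monic_cofactorMod h N (base h s)).1 hdvd
  rw [(monic_cofactorMod h N (base h s)).2] at hbase
  have hX : ∀ l ≤ s, h l = h s → cofactorMod h N l = X ^ l := fun l hl hls => by
    rw [hblock l hl hls, hbase, ← pow_add, Nat.sub_add_cancel (base_le h hls)]
  refine ⟨hX s le_rfl rfl, fun l hl hls => ?_⟩
  have h1 := cofactorMod_succ hh hN s
  rw [hs, hX s le_rfl rfl, ← pow_succ', eq_comm, sub_eq_self] at h1
  have h2 := congrArg (fun f => coeff f l) h1
  simp only [finsetSum_coeff, coeff_zero] at h2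
  rw [Finset.sum_eq_single l] at h2
  · rw [if_pos hls, hX l hl hls, coeff_C_mul_X_pow, if_pos rfl] at h2
    exact h2
  · intro b hb hbl
    split_ifs with hbs
    · rw [hX b (Nat.lt_succ_iff.1 (Finset.mem_range.1 hb)) hbs, coeff_C_mul_X_pow,
        if_neg hbl.symm]
    · exact coeff_zero _
  · intro hb
    exact absurd (Finset.mem_range.2 (Nat.lt_succ_of_le hl)) hb

/-- Modulo `y` the generators with `s < t` vanish, since their factor `y^(h s)` has `h s > 0`; those
with `s ≥ t` are multiples of the cofactor at `t`. -/
theorem IsCanonical.cofactorMod_dvd (H : IsCanonical h F N) (hh : Antitone h) (ht : h t = 0)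
    (hpos : ∀ s < t, 0 < h s) (hN : ∀ s, N s (s + 1) = 0) {f : K[X][X]}
    (hf : f ∈ Ideal.span (Set.range F)) : cofactorMod h N t ∣ f.map constantCoeff := by
  have hle : Ideal.span (Set.range F) ≤
      (Ideal.span {cofactorMod h N t}).comap (mapRingHom constantCoeff) := by
    rw [Ideal.span_le]
    rintro _ ⟨s, rfl⟩
    rw [SetLike.mem_coe, Ideal.mem_comap, Ideal.mem_span_singleton, coe_mapRingHom,
      H.eq_syzFamily hh ht, syzFamily, smul_eq_C_mul, Polynomial.map_mul, map_C]
    rcases lt_or_ge s t with hst | hst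
    · rw [constantCoeff_prod_diagEntry hh hN hst.le, if_neg (by have := hpos s hst; omega), C_0,
        zero_mul]
      exact dvd_zero _
    · refine Dvd.dvd.mul_left ?_ _
      have := hh hst
      exact Dvd.intro_left _ (cofactorMod_eq_X_pow_mul hh H hst (by omega)).symm
  simpa only [Ideal.mem_comap, Ideal.mem_span_singleton, coe_mapRingHom] using hle hf

theorem IsCanonical.X_mem_radical_iff (H : IsCanonical h F N) (hh : Antitone h) (ht : h t = 0)
    (hpos : ∀ s < t, 0 < h s) (hN : ∀ s, N s (s + 1) = 0) :
    X ∈ (Ideal.span (Set.range F)).radical ↔ ∀ s, ∀ l ≤ s, h l = h s → (N s l).coeff 0 = 0 := by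
  constructor
  · rintro ⟨n, hn⟩
    have h1 := H.cofactorMod_dvd hh ht hpos hN hn
    rw [Polynomial.map_pow, map_X] at h1
    have h2 := eq_X_pow_of_monic_of_dvd (monic_cofactorMod h N t).1 h1
    rw [(monic_cofactorMod h N t).2] at h2
    have h3 : ∀ s ≤ t, cofactorMod h N s = X ^ s := fun s hst =>
      Nat.decreasingInduction (motive := fun s _ => cofactorMod h N s = X ^ s)
        (fun s _ hs => (cofactorMod_descend hh H hN hs).1) h2 hst
    intro s l hl hls
    rcases lt_or_ge s t with hst | hst
    · exact (cofactorMod_descend hh H hN (h3 (s + 1) hst)).2 l hl hls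
    · have := hh hst
      rw [H.eq_zero_of_eq (by omega) (hl.trans s.le_succ), coeff_zero]
  · intro hc
    have h1 : cofactorMod h N t = X ^ t := by
      generalize t = s
      induction s with
      | zero => rw [cofactorMod, cofactor_zero, Polynomial.map_one, pow_zero]
      | succ s ih =>
        rw [cofactorMod_succ hh hN, ih, Finset.sum_eq_zero, sub_zero, pow_succ']
        intro l hl
        split_ifs with hls
        · rw [hc s l (Nat.lt_succ_iff.1 (Finset.mem_range.1 hl)) hls, C_0, zero_mul]
        · rfl
    -- The cofactor at `t` equals `F t`, so it lies in the ideal. It is congruent to `x^t` modulo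
    -- `y`, and `y` lies in the radical.
    have h2 : (C X : K[X][X]) ∣ cofactor h N t - X ^ t := by
      rw [C_dvd_iff_dvd_coeff]
      intro i
      rw [X_dvd_iff, ← constantCoeff_apply, ← coeff_map, Polynomial.map_sub, Polynomial.map_pow,
        map_X, ← cofactorMod, h1, sub_self, coeff_zero]
    have hF : cofactor h N t ∈ Ideal.span (Set.range F) := by
      have h3 : syzFamily h t N t ∈ Ideal.span (Set.range F) := by
        rw [← congrFun (H.eq_syzFamily hh ht) t]
        exact mem_span t
      rwa [syzFamily, Finset.Ico_self, Finset.prod_empty, one_smul] at h3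
    have h4 : (X : K[X][X]) ^ t ∈ (Ideal.span (Set.range F)).radical := by
      have h5 := Ideal.sub_mem _ (Ideal.le_radical hF)
        (Ideal.mem_of_dvd _ h2 ((H.C_X_mem_radical_iff hh ht).2 hN))
      rwa [sub_sub_cancel] at h5
    rw [← Ideal.radical_idem]
    exact ⟨t, h4⟩

end Radical

end GroebnerCell

namespace GroebnerCell

/-! ### Homogeneity in terms of the syzygy matrix. -/

section Homogeneous

open Polynomial

/-- Homogeneity of degree `n` of a polynomial in two variables. -/
def IsHomog {A : Type*} [CommRing A] (n : ℕ) (f : A[X][X]) : Prop :=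
  ∀ a b, (f.coeff a).coeff b ≠ 0 → a + b = n

/-- The component of degree `n` of a polynomial in two variables. -/
noncomputable def homogPart {A : Type*} [CommRing A] (n : ℕ) (f : A[X][X]) : A[X][X] :=
  ∑ a ∈ Finset.range (n + 1), monomial a (monomial (n - a) ((f.coeff a).coeff (n - a)))

section Ring

variable {A : Type*} [CommRing A] {n m : ℕ} {f g : A[X][X]}

theorem coeff_homogPart (n : ℕ) (f : A[X][X]) (a b : ℕ) :
    ((homogPart n f).coeff a).coeff b = if a + b = n then (f.coeff a).coeff b else 0 := by
  simp only [homogPart, finsetSum_coeff, coeff_monomial]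
  rw [Finset.sum_congr rfl fun i _ => apply_ite (fun p : A[X] => p.coeff b) _ _ _]
  simp only [coeff_monomial, coeff_zero]
  rw [Finset.sum_ite_eq' (Finset.range (n + 1)) a]
  simp only [Finset.mem_range]
  split_ifs with h1 h2 h3 h4 h5
  · rw [h2]
  · omega
  · omega
  · rfl
  · omega
  · rfl

theorem IsHomog.homogPart_eq (hf : IsHomog n f) : homogPart n f = f := by
  ext a b
  rw [coeff_homogPart]
  split_ifs with hab
  · rfl
  · by_contra hne
    exact hab (hf a b (Ne.symm hne))

theorem isHomog_homogPart (n : ℕ) (f : A[X][X]) : IsHomog n (homogPart n f) := fun a b hab => by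
  rw [coeff_homogPart] at hab
  by_contra hne
  exact hab (if_neg hne)

theorem homogPart_add (n : ℕ) (f g : A[X][X]) :
    homogPart n (f + g) = homogPart n f + homogPart n g := by
  ext a b
  simp only [coeff_add, coeff_homogPart]
  split_ifs <;> simp

theorem homogPart_sum {ι : Type*} (n : ℕ) (S : Finset ι) (f : ι → A[X][X]) :
    homogPart n (∑ i ∈ S, f i) = ∑ i ∈ S, homogPart n (f i) := by
  ext a b
  simp only [finsetSum_coeff, coeff_homogPart]
  split_ifs <;> simp

theorem isHomog_zero (n : ℕ) : IsHomog n (0 : A[X][X]) := fun a b hab => by simp at hab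

theorem IsHomog.sub (hf : IsHomog n f) (hg : IsHomog n g) : IsHomog n (f - g) :=
  fun a b hab => by
    rw [coeff_sub, coeff_sub] at hab
    by_cases h1 : (f.coeff a).coeff b = 0
    · exact hg a b fun h2 => hab (by rw [h1, h2, sub_zero])
    · exact hf a b h1

theorem IsHomog.sum {ι : Type*} {S : Finset ι} {f : ι → A[X][X]}
    (hf : ∀ i ∈ S, IsHomog n (f i)) : IsHomog n (∑ i ∈ S, f i) := fun a b hab => by
  rw [finsetSum_coeff, finsetSum_coeff] at hab
  obtain ⟨i, hi, hne⟩ := Finset.exists_ne_zero_of_sum_ne_zero hab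
  exact hf i hi a b hne

theorem IsHomog.mul (hf : IsHomog n f) (hg : IsHomog m g) : IsHomog (n + m) (f * g) :=
  fun a b hab => by
    rw [coeff_mul, finsetSum_coeff] at hab
    obtain ⟨⟨i, j⟩, hij, h1⟩ := Finset.exists_ne_zero_of_sum_ne_zero hab
    rw [coeff_mul] at h1
    obtain ⟨⟨i', j'⟩, hij', h2⟩ := Finset.exists_ne_zero_of_sum_ne_zero h1
    have h3 := hf _ _ (left_ne_zero_of_mul h2)
    have h4 := hg _ _ (right_ne_zero_of_mul h2)
    rw [Finset.HasAntidiagonal.mem_antidiagonal] at hij hij'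
    dsimp only at *
    omega

theorem isHomog_X : IsHomog 1 (X : A[X][X]) := fun a b hab => by
  rw [coeff_X] at hab
  split_ifs at hab with h1
  · rw [coeff_one] at hab
    split_ifs at hab with h2
    · omega
    · exact absurd rfl hab
  · exact absurd (coeff_zero _) hab

theorem isHomog_one : IsHomog 0 (1 : A[X][X]) := fun a b hab => by
  rw [coeff_one] at hab
  split_ifs at hab with h1
  · rw [coeff_one] at hab
    split_ifs at hab with h2
    · omega
    · exact absurd rfl hab
  · exact absurd (coeff_zero _) hab

theorem isHomog_C {p : A[X]} (hp : ∀ b, p.coeff b ≠ 0 → b = n) : IsHomog n (C p) :=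
  fun a b hab => by
    rw [coeff_C] at hab
    split_ifs at hab with h1
    · rw [h1, zero_add]; exact hp b hab
    · exact absurd (coeff_zero _) hab

theorem isHomog_C_X_pow (n : ℕ) : IsHomog n (C (X ^ n) : A[X][X]) := isHomog_C fun b hb => by
  rw [coeff_X_pow] at hb
  by_contra hne
  exact hb (if_neg hne)

theorem IsHomog.smul {p : A[X]} (hp : ∀ b, p.coeff b ≠ 0 → b = n) (hf : IsHomog m f) :
    IsHomog (n + m) (p • f) := by
  rw [smul_eq_C_mul]
  exact (isHomog_C hp).mul hf

theorem homogPart_X_pow_smul (n d : ℕ) (f : A[X][X]) :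
    homogPart (n + d) ((X ^ d : A[X]) • f) = (X ^ d : A[X]) • homogPart n f := by
  ext a b
  rw [coeff_homogPart, coeff_smul, coeff_smul, smul_eq_mul, smul_eq_mul, coeff_X_pow_mul',
    coeff_X_pow_mul']
  by_cases hdb : d ≤ b
  · rw [if_pos hdb, if_pos hdb, coeff_homogPart]
    exact if_congr (by omega) rfl rfl
  · rw [if_neg hdb, if_neg hdb, ite_self]

theorem homogPart_smul (n : ℕ) (p : A[X]) (hf : IsHomog m f) :
    homogPart n (p • f) = (if m ≤ n then monomial (n - m) (p.coeff (n - m)) else 0 : A[X]) • f := by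
  ext a b
  rw [coeff_homogPart, coeff_smul, coeff_smul, smul_eq_mul, smul_eq_mul, coeff_mul, coeff_mul]
  trans ∑ ij ∈ Finset.HasAntidiagonal.antidiagonal b,
    if a + b = n then p.coeff ij.1 * (f.coeff a).coeff ij.2 else 0
  · split_ifs <;> simp
  refine Finset.sum_congr rfl fun ij hij => ?_
  rw [Finset.HasAntidiagonal.mem_antidiagonal] at hij
  by_cases h0 : (f.coeff a).coeff ij.2 = 0
  · simp [h0]
  · have h1 := hf _ _ h0
    by_cases hab : a + b = n
    · have hmn : m ≤ n := by omega
      rw [if_pos hab, if_pos hmn, coeff_monomial, show n - m = ij.1 by omega, if_pos rfl]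
    · rw [if_neg hab]
      split_ifs with hmn
      · rw [coeff_monomial, if_neg (by omega), zero_mul]
      · rw [coeff_zero, zero_mul]

end Ring

variable {K : Type*} [Field K] {h : ℕ → ℕ} {F : ℕ → K[X][X]} {N : ℕ → ℕ → K[X]} {t : ℕ}

/-- The entries of the syzygy matrix are homogeneous of the degrees which make the family
homogeneous. -/
def IsHomogData (h : ℕ → ℕ) (N : ℕ → ℕ → K[X]) : Prop :=
  ∀ s l, l ≤ s + 1 → ∀ e, (N s l).coeff e ≠ 0 → e + h l + l = h s + s + 1

/-- The only exponent that homogeneity allows here is `h s - h (s+1)`, just outside the degree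
bound. -/
theorem IsCanonical.diag_eq_zero (H : IsCanonical h F N) (hh : Antitone h)
    (hN : IsHomogData h N) (s : ℕ) : N s (s + 1) = 0 := by
  ext e
  by_contra hne
  have h1 := hN s (s + 1) le_rfl e hne
  have h2 := (le_degree_of_ne_zero hne).trans_lt (H.degree_lt s (s + 1) le_rfl)
  rw [Nat.cast_lt] at h2
  have := hh (Nat.le_add_right s 1)
  omega

theorem IsCanonical.isHomog_cofactor (H : IsCanonical h F N) (hh : Antitone h)
    (hN : IsHomogData h N) (s : ℕ) : IsHomog s (cofactor h N s) := by
  induction s using Nat.strong_induction_on with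
  | _ s ih =>
    cases s with
    | zero => rw [cofactor_zero]; exact isHomog_one
    | succ s =>
      rw [cofactor_succ]
      refine IsHomog.sub ?_ (IsHomog.sum fun l hl => ?_)
      · rw [add_comm]
        exact isHomog_X.mul (ih s s.lt_succ_self)
      · have hl' := Finset.mem_range.1 hl
        by_cases h0 : N s l = 0
        · rw [h0, zero_mul, zero_smul]
          exact isHomog_zero _
        · have hls : l ≤ s := Nat.lt_succ_iff.1 hl'
          have hle := hh hls
          have hlead := hN s l hl'.le _ (by rwa [coeff_natDegree, leadingCoeff_ne_zero])
          simp only [diagEntry, H.diag_eq_zero hh hN, add_zero, Finset.prod_pow_eq_pow_sum,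
            sum_Ico_sub_of_antitone hh hls]
          rw [show s + 1 = (s + 1 - l) + l by omega]
          refine IsHomog.smul (fun b hb => ?_) (ih l hl')
          rw [coeff_mul_X_pow'] at hb
          split_ifs at hb with hb1
          · have := hN s l hl'.le _ hb
            omega
          · exact absurd rfl hb

theorem IsCanonical.isHomog_of_isHomogData (H : IsCanonical h F N) (hh : Antitone h)
    (ht : h t = 0) (hN : IsHomogData h N) (s : ℕ) : IsHomog (h s + s) (F s) := by
  have h1 := H.coeff_self hh ht s
  rw [H.coeff_self_eq_X_pow hh ht (H.diag_eq_zero hh hN)] at h1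
  have h2 : F s = (X ^ h s : K[X]) • cofactor h N s := by
    rw [h1, H.eq_syzFamily hh ht, syzFamily]
  rw [h2]
  refine IsHomog.smul (fun b hb => ?_) (H.isHomog_cofactor hh hN s)
  rw [coeff_X_pow] at hb
  by_contra hne
  exact hb (if_neg hne)

/-- Taking the expected homogeneous component of the `s`-th relation gives another relation of the
same reduced shape inside the ideal. By `succ_unique` it is the original one, so `F (s + 1)` and the
entries equal their own homogeneous components. -/
theorem IsCanonical.isHomogData (H : IsCanonical h F N) (hh : Antitone h) (ht : h t = 0)
    (hI : ∀ n, ∀ f ∈ Ideal.span (Set.range F), homogPart n f ∈ Ideal.span (Set.range F)) :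
    IsHomogData h N := by
  have hF0 : homogPart (h 0) (F 0) = C (X ^ h 0) := by
    ext a b
    rw [coeff_homogPart, H.zero_eq, coeff_C, coeff_C]
    split_ifs with h1 h2 h3
    · rw [coeff_X_pow, if_pos (by omega), show b = h 0 by omega, ← H.adapted.natDegree_coeff 0,
        coeff_natDegree, H.adapted.monic 0]
    · rfl
    · rw [coeff_X_pow, if_neg (by omega)]
    · rfl
  -- The top component of `F 0` is `y^(h 0)`. It lies in the ideal, so the radical criterion for `y`
  -- applies.
  have hdiag : ∀ s, N s (s + 1) = 0 := by
    rw [← H.C_X_mem_radical_iff hh ht]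
    exact ⟨h 0, by rw [← C_pow, ← hF0]; exact hI _ _ (mem_span 0)⟩
  have hcoeff := H.coeff_self_eq_X_pow hh ht hdiag
  have step : ∀ s, (∀ l ≤ s, IsHomog (h l + l) (F l)) →
      IsHomog (h (s + 1) + (s + 1)) (F (s + 1)) ∧
      ∀ l ≤ s, ∀ e, (N s l).coeff e ≠ 0 → e + h l + l = h s + s + 1 := by
    intro s ih
    have hs := hh (Nat.le_add_right s 1)
    -- In degree `h s + s + 1` each entry keeps just one monomial; the `if` guards the truncated
    -- subtraction in its exponent.
    have hrel : X * F s = ∑ l ∈ Finset.range (s + 1),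
        (if h l + l ≤ h s + s + 1 then monomial (h s + s + 1 - (h l + l))
          ((N s l).coeff (h s + s + 1 - (h l + l))) else 0 : K[X]) • F l +
        (X ^ (h s - h (s + 1)) : K[X]) • homogPart (h (s + 1) + (s + 1)) (F (s + 1)) := by
      have h1 : IsHomog (h s + s + 1) (X * F s) := by
        rw [add_comm]; exact isHomog_X.mul (ih s le_rfl)
      rw [← h1.homogPart_eq, H.rel s, homogPart_add, homogPart_sum, diagEntry, hdiag, add_zero,
        ← homogPart_X_pow_smul]
      refine congrArg₂ (· + ·) (Finset.sum_congr rfl fun l hl => ?_) ?_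
      · exact homogPart_smul _ _ (ih l (Nat.lt_succ_iff.1 (Finset.mem_range.1 hl)))
      · rw [show h (s + 1) + (s + 1) + (h s - h (s + 1)) = h s + s + 1 by omega]
    have hlc : (homogPart (h (s + 1) + (s + 1)) (F (s + 1))).coeff (s + 1) = X ^ h (s + 1) := by
      ext b
      rw [coeff_homogPart, hcoeff, coeff_X_pow]
      split_ifs <;> first | rfl | omega
    obtain ⟨h1, -, h3⟩ := H.succ_unique (hI (h (s + 1) + (s + 1)) _ (mem_span (s + 1)))
      (natDegree_le_iff_coeff_eq_zero.2 fun a ha => by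
        ext b
        rw [coeff_homogPart, H.adapted.coeff_eq_zero ha, coeff_zero, ite_self])
      (by rw [hlc]; exact monic_X_pow _) (by rw [hlc, natDegree_X_pow])
      (monic_X_pow (h s - h (s + 1))) (natDegree_X_pow _) (fun l hl => by
        split_ifs with hle
        · rcases eq_or_ne ((N s l).coeff (h s + s + 1 - (h l + l))) 0 with h0 | h0
          · rw [h0, monomial_zero_right, degree_zero]
            exact WithBot.bot_lt_coe _
          · exact (degree_monomial_le _ _).trans_lt
              ((le_degree_of_ne_zero h0).trans_lt (H.degree_lt s l (hl.trans s.le_succ)))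
        · rw [degree_zero]
          exact WithBot.bot_lt_coe _) hrel
    refine ⟨h1 ▸ isHomog_homogPart _ _, fun l hl e he => ?_⟩
    rw [← h3 l hl] at he
    split_ifs at he with hle
    · rw [coeff_monomial] at he
      by_contra hne
      exact he (if_neg (by omega))
    · exact absurd (coeff_zero _) he
  have hF : ∀ s, IsHomog (h s + s) (F s) := fun s => by
    induction s using Nat.strong_induction_on with
    | _ s ih =>
      cases s with
      | zero =>
        rw [H.zero_eq, hcoeff]
        exact isHomog_C_X_pow _
      | succ s => exact (step s fun l hl => ih l (Nat.lt_succ_iff.2 hl)).1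
  intro s l hl e he
  rcases Nat.lt_succ_iff_lt_or_eq.1 (Nat.lt_succ_iff.2 hl) with hl | rfl
  · exact (step s fun l _ => hF l).2 l (by omega) e he
  · rw [hdiag, coeff_zero] at he
    exact absurd rfl he

end Homogeneous

end GroebnerCell

namespace GroebnerCell

open MvPolynomial
open scoped MonomialOrder

/-! ### Translation between `K[x,y]` and `K[y][x]`. -/

section Transport

/-- The exponent vector of `x ^ a * y ^ b`. -/
noncomputable def mon (a b : ℕ) : Mon := Finsupp.single 0 a + Finsupp.single 1 b

@[simp] theorem mon_apply_zero (a b : ℕ) : mon a b 0 = a := by simp [mon]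

@[simp] theorem mon_apply_one (a b : ℕ) : mon a b 1 = b := by simp [mon]

theorem mon_eta (m : Mon) : mon (m 0) (m 1) = m := by
  ext i
  fin_cases i <;> simp

theorem mon_le_mon {a b a' b' : ℕ} : mon a b ≤ mon a' b' ↔ a ≤ a' ∧ b ≤ b' := by
  rw [Finsupp.le_def, Fin.forall_fin_two]
  simp

theorem mon_inj {a b a' b' : ℕ} : mon a b = mon a' b' ↔ a = a' ∧ b = b' := by
  rw [Finsupp.ext_iff, Fin.forall_fin_two]
  simp

theorem lex_lt_mon_iff {a b a' b' : ℕ} :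
    mon a b ≺[lexOrder] mon a' b' ↔ a < a' ∨ a = a' ∧ b < b' := by
  rw [MonomialOrder.lex_lt_iff, Finsupp.Lex.lt_iff]
  constructor
  · rintro ⟨i, hi, hlt⟩
    fin_cases i
    · left; simpa using hlt
    · right
      exact ⟨by simpa using hi 0 (by simp), by simpa using hlt⟩
  · rintro (hlt | ⟨rfl, hlt⟩)
    · exact ⟨0, fun j hj => absurd hj (Fin.not_lt_zero j), by simpa using hlt⟩
    · refine ⟨1, fun j hj => ?_, by simpa using hlt⟩
      obtain rfl : j = 0 := by omega
      simp

variable {K : Type*} [Field K]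

/-- The isomorphism `K[x,y] ≃ K[y][x]`. -/
noncomputable def toBi : MvPolynomial (Fin 2) K ≃+* Polynomial (Polynomial K) :=
  RingEquiv.ofRingHom
    (eval₂Hom (Polynomial.C.comp Polynomial.C) ![Polynomial.X, Polynomial.C Polynomial.X])
    (Polynomial.eval₂RingHom (Polynomial.eval₂RingHom C (X 1)) (X 0))
    (by ext <;> simp)
    (by
      ext i
      · simp
      · fin_cases i <;> simp)

theorem toBi_C (c : K) : toBi (C c) = Polynomial.C (Polynomial.C c) := by simp [toBi]

theorem toBi_X_zero : toBi (X 0 : MvPolynomial (Fin 2) K) = Polynomial.X := by simp [toBi]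

theorem toBi_X_one : toBi (X 1 : MvPolynomial (Fin 2) K) = Polynomial.C Polynomial.X := by
  simp [toBi]

theorem toBi_monomial (m : Mon) (c : K) :
    toBi (monomial m c) = Polynomial.monomial (m 0) (Polynomial.monomial (m 1) c) := by
  rw [monomial_eq, Finsupp.prod_fintype _ _ fun i => pow_zero _, Fin.prod_univ_two, map_mul,
    map_mul, map_pow, map_pow, toBi_C, toBi_X_zero, toBi_X_one,
    ← Polynomial.C_mul_X_pow_eq_monomial, ← Polynomial.C_mul_X_pow_eq_monomial, Polynomial.C_mul,
    Polynomial.C_pow]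
  ring

theorem coeff_toBi (f : MvPolynomial (Fin 2) K) (a b : ℕ) :
    ((toBi f).coeff a).coeff b = f.coeff (mon a b) := by
  induction f using MvPolynomial.induction_on' with
  | monomial m c =>
    rw [toBi_monomial, Polynomial.coeff_monomial, coeff_monomial, ← mon_eta m]
    simp only [mon_inj, mon_apply_zero, mon_apply_one]
    split_ifs with h1 h2 h2
    · rw [Polynomial.coeff_monomial, if_pos h2.2]
    · rw [Polynomial.coeff_monomial, if_neg fun h3 => h2 ⟨h1, h3⟩]
    · exact absurd h2.1 h1
    · exact Polynomial.coeff_zero _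
  | add f g hf hg => rw [map_add, Polynomial.coeff_add, Polynomial.coeff_add, hf, hg, coeff_add]

/-- Because `x > y` lexicographically, the leading monomial is found by taking the `x`-degree first
and then the `y`-degree of the leading coefficient. -/
theorem degree_eq_mon {f : MvPolynomial (Fin 2) K} (hf : f ≠ 0) :
    lexOrder.degree f = mon (toBi f).natDegree (toBi f).leadingCoeff.natDegree := by
  have hf' : toBi f ≠ 0 := by rwa [Ne, EmbeddingLike.map_eq_zero_iff]
  refine lexOrder.toSyn.injective (le_antisymm (lexOrder.degree_le_iff.2 fun m hm => ?_)
    (lexOrder.le_degree ?_))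
  · rw [← mon_eta m] at hm ⊢
    rw [mem_support_iff, ← coeff_toBi] at hm
    rw [← not_lt, lex_lt_mon_iff]
    have h1 : m 0 ≤ (toBi f).natDegree := Polynomial.le_natDegree_of_ne_zero fun h => by
      rw [h, Polynomial.coeff_zero] at hm
      exact hm rfl
    rintro (h2 | ⟨h2, h3⟩)
    · omega
    · rw [← h2] at hm
      exact absurd (Polynomial.le_natDegree_of_ne_zero hm) (not_le.2 h3)
  · rw [mem_support_iff, ← coeff_toBi, Polynomial.coeff_natDegree, Polynomial.coeff_natDegree,
      Polynomial.leadingCoeff_ne_zero, Polynomial.leadingCoeff_ne_zero]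
    exact hf'

/-- The ideal of `K[y][x]` corresponding to an ideal of `K[x,y]`. -/
noncomputable def biIdeal (I : Ideal (MvPolynomial (Fin 2) K)) :
    Ideal (Polynomial (Polynomial K)) :=
  I.comap (toBi (K := K)).symm

theorem mem_biIdeal {I : Ideal (MvPolynomial (Fin 2) K)} {f : Polynomial (Polynomial K)} :
    f ∈ biIdeal I ↔ toBi.symm f ∈ I := Iff.rfl

theorem toBi_mem_biIdeal {I : Ideal (MvPolynomial (Fin 2) K)} {f : MvPolynomial (Fin 2) K} :
    toBi f ∈ biIdeal I ↔ f ∈ I := by rw [mem_biIdeal, RingEquiv.symm_apply_apply]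

theorem toBi_mem_radical_biIdeal {I : Ideal (MvPolynomial (Fin 2) K)}
    {f : MvPolynomial (Fin 2) K} : toBi f ∈ (biIdeal I).radical ↔ f ∈ I.radical := by
  simp only [Ideal.mem_radical_iff, ← map_pow, toBi_mem_biIdeal]

theorem exists_biIdeal_eq (J : Ideal (Polynomial (Polynomial K))) :
    ∃ I : Ideal (MvPolynomial (Fin 2) K), biIdeal I = J := by
  refine ⟨J.comap (toBi (K := K)), ?_⟩
  ext f
  rw [mem_biIdeal, Ideal.mem_comap, RingEquiv.apply_symm_apply]

attribute [local instance] MvPolynomial.gradedAlgebra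

theorem toBi_homogeneousComponent (n : ℕ) (f : MvPolynomial (Fin 2) K) :
    toBi (homogeneousComponent n f) = homogPart n (toBi f) := by
  ext a b
  rw [coeff_toBi, coeff_homogPart, coeff_homogeneousComponent, coeff_toBi]
  refine if_congr ?_ rfl rfl
  rw [Finsupp.degree_eq_sum, Fin.sum_univ_two, mon_apply_zero, mon_apply_one]

theorem IsHomog.isHomogeneous {n : ℕ} {f : Polynomial (Polynomial K)} (hf : IsHomog n f) :
    (toBi.symm f).IsHomogeneous n := by
  have h1 : homogeneousComponent n (toBi.symm f) = toBi.symm f := by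
    apply toBi.injective
    rw [toBi_homogeneousComponent, RingEquiv.apply_symm_apply, hf.homogPart_eq]
  rw [← h1]
  exact homogeneousComponent_isHomogeneous n _

theorem homogPart_mem_biIdeal {I : Ideal (MvPolynomial (Fin 2) K)}
    (hI : I.IsHomogeneous (homogeneousSubmodule (Fin 2) K)) (n : ℕ)
    {f : Polynomial (Polynomial K)} (hf : f ∈ biIdeal I) : homogPart n f ∈ biIdeal I := by
  rw [← RingEquiv.apply_symm_apply toBi f, ← toBi_homogeneousComponent, toBi_mem_biIdeal]
  exact homogeneousComponent_mem_of_mem hI hf n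

theorem isHomogeneous_of_biIdeal_eq_span {I : Ideal (MvPolynomial (Fin 2) K)}
    {F : ℕ → Polynomial (Polynomial K)} {e : ℕ → ℕ} (hI : biIdeal I = Ideal.span (Set.range F))
    (hF : ∀ s, IsHomog (e s) (F s)) : I.IsHomogeneous (homogeneousSubmodule (Fin 2) K) := by
  have h1 : I = Ideal.span (Set.range fun s => toBi.symm (F s)) := by
    refine le_antisymm (fun f hf => ?_) (Ideal.span_le.2 ?_)
    · rw [← toBi_mem_biIdeal, hI] at hf
      have h2 := Ideal.mem_map_of_mem (toBi (K := K)).symm hf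
      rw [Ideal.map_span, ← Set.range_comp, RingEquiv.symm_apply_apply] at h2
      exact h2
    · rintro _ ⟨s, rfl⟩
      rw [SetLike.mem_coe, ← mem_biIdeal, hI]
      exact Ideal.subset_span (Set.mem_range_self s)
  rw [h1]
  refine Ideal.homogeneous_span _ _ ?_
  rintro _ ⟨s, rfl⟩
  exact ⟨e s, (hF s).isHomogeneous⟩

end Transport

/-! ### Monomial ideals of finite colength and their staircases. -/

section MonomialIdeal

variable {k : Type u} [Field k] {E : Ideal (Poly k)}

theorem IsMonomialIdeal.mem_iff (hmon : IsMonomialIdeal E) {f : Poly k} :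
    f ∈ E ↔ ∀ m ∈ f.support, (monomial m (1 : k) : Poly k) ∈ E := by
  obtain ⟨S, rfl⟩ := hmon
  simp only [mem_ideal_span_monomial_image]
  refine forall₂_congr fun m _ => ⟨fun hm b hb => ?_, fun hm => hm m (by simp)⟩
  have := MvPolynomial.support_monomial_subset hb
  rw [Finset.mem_singleton] at this
  rwa [this]

theorem monomial_mem_of_le {m m' : Mon} (hm : (monomial m (1 : k) : Poly k) ∈ E) (hle : m ≤ m') :
    (monomial m' (1 : k) : Poly k) ∈ E := by
  obtain ⟨c, rfl⟩ := exists_add_of_le hle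
  rw [← mul_one (1 : k), ← monomial_mul]
  exact E.mul_mem_right _ hm

theorem IsMonomialIdeal.eq_of_monomial_mem_iff {E' : Ideal (Poly k)} (hmon : IsMonomialIdeal E)
    (hmon' : IsMonomialIdeal E')
    (hEE' : ∀ m, (monomial m (1 : k) : Poly k) ∈ E ↔ (monomial m (1 : k) : Poly k) ∈ E') :
    E = E' := by
  ext f
  rw [hmon.mem_iff, hmon'.mem_iff]
  simp only [hEE']

theorem isMonomialIdeal_leadingIdeal (I : Ideal (Poly k)) : IsMonomialIdeal (leadingIdeal I) :=
  ⟨lexOrder.degree '' ((I : Set (Poly k)) \ {0}), by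
    rw [leadingIdeal, MonomialOrder.span_leadingTerm_eq_span_monomial', Set.image_image]⟩

theorem monomial_mem_leadingIdeal_iff {I : Ideal (Poly k)} {m : Mon} :
    (monomial m (1 : k) : Poly k) ∈ leadingIdeal I ↔ ∃ f ∈ I, f ≠ 0 ∧ lexOrder.degree f ≤ m := by
  rw [leadingIdeal, MonomialOrder.span_leadingTerm_eq_span_monomial',
    ← Set.image_image (fun a : Mon => (monomial a (1 : k) : Poly k)) lexOrder.degree,
    mem_ideal_span_monomial_image]
  classical
  rw [support_monomial, if_neg one_ne_zero]
  constructor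
  · intro hm
    obtain ⟨_, ⟨f, ⟨hf, hf0⟩, rfl⟩, hle⟩ := hm m (Finset.mem_singleton_self m)
    exact ⟨f, hf, hf0, hle⟩
  · rintro ⟨f, hf, hf0, hle⟩ m' hm'
    rw [Finset.mem_singleton.1 hm']
    exact ⟨_, ⟨f, ⟨hf, hf0⟩, rfl⟩, hle⟩

theorem IsMonomialIdeal.baseChange (hmon : IsMonomialIdeal E) (K : Type u) [Field K]
    [Algebra k K] : IsMonomialIdeal (baseChange K E) := by
  obtain ⟨S, rfl⟩ := hmon
  refine ⟨S, ?_⟩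
  rw [GroebnerCell.baseChange, Ideal.map_span, Set.image_image]
  simp

theorem IsMonomialIdeal.monomial_mem_baseChange_iff (hmon : IsMonomialIdeal E) (K : Type u)
    [Field K] [Algebra k K] {m : Mon} :
    (monomial m (1 : K) : Poly K) ∈ GroebnerCell.baseChange K E ↔
      (monomial m (1 : k) : Poly k) ∈ E := by
  obtain ⟨S, rfl⟩ := hmon
  rw [GroebnerCell.baseChange, Ideal.map_span, Set.image_image]
  simp only [map_monomial, map_one]
  classical
  rw [mem_ideal_span_monomial_image, mem_ideal_span_monomial_image, support_monomial,
    support_monomial, if_neg one_ne_zero, if_neg one_ne_zero]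

/-- The staircase of `E`: the least `b` with `x ^ a * y ^ b ∈ E`. -/
noncomputable def stair (E : Ideal (Poly k)) (a : ℕ) : ℕ :=
  sInf {b | (monomial (mon a b) (1 : k) : Poly k) ∈ E}

theorem isCompl_restrictSupport (s : Set Mon) :
    IsCompl (restrictSupport k s) (restrictSupport k sᶜ) := by
  constructor
  · rw [Submodule.disjoint_def]
    intro f hf hf'
    rw [mem_restrictSupport_iff] at hf hf'
    by_contra hne
    obtain ⟨m, hm⟩ := support_nonempty.2 hne
    exact hf' hm (hf hm)
  · rw [codisjoint_iff, eq_top_iff]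
    intro f _
    induction f using MvPolynomial.induction_on' with
    | monomial m c =>
      by_cases hm : m ∈ s
      · exact Submodule.mem_sup_left ((monomial_mem_restrictSupport k).2 (Or.inl hm))
      · exact Submodule.mem_sup_right ((monomial_mem_restrictSupport k).2 (Or.inl hm))
    | add f g hf hg => exact Submodule.add_mem _ (hf trivial) (hg trivial)

/-- The monomials outside a monomial ideal form a basis of the quotient. -/
noncomputable def IsMonomialIdeal.basisQuotient (hmon : IsMonomialIdeal E) :
    Module.Basis ({m : Mon | (monomial m (1 : k) : Poly k) ∈ E}ᶜ : Set Mon) k (Poly k ⧸ E) :=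
  (basisRestrictSupport k {m : Mon | (monomial m (1 : k) : Poly k) ∈ E}ᶜ).map
    ((Submodule.quotientEquivOfIsCompl (E.restrictScalars k) _ (by
      have h1 : E.restrictScalars k =
          restrictSupport k {m : Mon | (monomial m (1 : k) : Poly k) ∈ E} := by
        ext f
        rw [Submodule.restrictScalars_mem, hmon.mem_iff, mem_restrictSupport_iff]
        rfl
      rw [h1]
      exact isCompl_restrictSupport _)).symm.trans
    (Submodule.Quotient.restrictScalarsEquiv k E))

theorem IsMonomialIdeal.finite_compl (hmon : IsMonomialIdeal E)
    (hfin : Module.Finite k (Poly k ⧸ E)) :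
    {m : Mon | (monomial m (1 : k) : Poly k) ∈ E}ᶜ.Finite :=
  Module.Finite.finite_basis hmon.basisQuotient

theorem IsMonomialIdeal.finrank_eq (hmon : IsMonomialIdeal E) :
    Module.finrank k (Poly k ⧸ E) =
      {m : Mon | (monomial m (1 : k) : Poly k) ∈ E}ᶜ.ncard := by
  rw [Module.finrank_eq_nat_card_basis hmon.basisQuotient, Nat.card_coe_set_eq]

theorem exists_monomial_mem (hfin : {m : Mon | (monomial m (1 : k) : Poly k) ∈ E}ᶜ.Finite)
    {u : ℕ → Mon} (hu : Function.Injective u) : ∃ j, (monomial (u j) (1 : k) : Poly k) ∈ E := by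
  by_contra hne
  push Not at hne
  exact Set.infinite_of_injective_forall_mem hu hne hfin

/-- The facts about the staircase of a monomial ideal of finite colength. -/
structure IsStaircase (E : Ideal (Poly k)) : Prop where
  mem_iff : ∀ a b, (monomial (mon a b) (1 : k) : Poly k) ∈ E ↔ stair E a ≤ b
  antitone : Antitone (stair E)
  xMin_eq : stair E (xMin E) = 0
  pos : ∀ s < xMin E, 0 < stair E s

theorem X_zero_pow_eq (j : ℕ) : (X 0 : Poly k) ^ j = monomial (mon j 0) 1 := by
  rw [X_pow_eq_monomial, mon, Finsupp.single_zero, add_zero]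

theorem X_one_pow_eq (j : ℕ) : (X 1 : Poly k) ^ j = monomial (mon 0 j) 1 := by
  rw [X_pow_eq_monomial, mon, Finsupp.single_zero, zero_add]

theorem IsMonomialIdeal.isStaircase (hmon : IsMonomialIdeal E)
    (hfin : Module.Finite k (Poly k ⧸ E)) : IsStaircase E := by
  have hf := hmon.finite_compl hfin
  have hmem : ∀ a b, (monomial (mon a b) (1 : k) : Poly k) ∈ E ↔ stair E a ≤ b := fun a b => by
    -- Finite colength puts a monomial of each column into `E`, so the infimum is attained and is
    -- not the default value `0`.
    have hne : {b | (monomial (mon a b) (1 : k) : Poly k) ∈ E}.Nonempty :=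
      exists_monomial_mem hf (u := mon a) fun b b' hb => (mon_inj.1 hb).2
    exact ⟨fun hb => Nat.sInf_le hb, fun hb =>
      monomial_mem_of_le (Nat.sInf_mem hne) (mon_le_mon.2 ⟨le_rfl, hb⟩)⟩
  have hx : ∀ j, (X 0 : Poly k) ^ j ∈ E ↔ stair E j = 0 := fun j => by
    rw [X_zero_pow_eq, hmem, Nat.le_zero]
  refine ⟨hmem, fun a a' ha => (hmem _ _).1
    (monomial_mem_of_le ((hmem a _).2 le_rfl) (mon_le_mon.2 ⟨ha, le_rfl⟩)), ?_, fun s hs => ?_⟩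
  · rw [← hx]
    obtain ⟨j, hj⟩ := exists_monomial_mem hf (u := fun j => mon j 0)
      fun b b' hb => (mon_inj.1 hb).1
    rw [← X_zero_pow_eq] at hj
    exact Nat.sInf_mem (s := {j | (X 0 : Poly k) ^ j ∈ E}) ⟨j, hj⟩
  · rw [Nat.pos_iff_ne_zero, Ne, ← hx]
    exact fun h => absurd (Nat.sInf_le (s := {j | (X 0 : Poly k) ^ j ∈ E}) h) (not_le.2 hs)

theorem yMin_eq (E : Ideal (Poly k)) : yMin E = stair E 0 := by
  simp only [yMin, stair, X_one_pow_eq]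

theorem mSeq_eq (E : Ideal (Poly k)) (i : ℕ) : mSeq E i = stair E (xMin E - i) := by
  simp only [mSeq, stair, X_zero_pow_eq, X_one_pow_eq, monomial_mul, mul_one]
  simp only [mon, Finsupp.single_zero, add_zero, zero_add]

namespace IsStaircase

theorem xMin_pos (hE : IsStaircase E) (hne : E ≠ ⊤) : 0 < xMin E := by
  rw [Nat.pos_iff_ne_zero]
  intro h0
  have h1 := (hE.mem_iff 0 0).2 (by exact (h0 ▸ hE.xMin_eq).le)
  refine hne (E.eq_top_of_isUnit_mem h1 ?_)
  rw [← X_zero_pow_eq, pow_zero]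
  exact isUnit_one

theorem ncard_compl (hE : IsStaircase E) :
    {m : Mon | (monomial m (1 : k) : Poly k) ∈ E}ᶜ.ncard =
    ∑ a ∈ Finset.range (xMin E), stair E a := by
  have h1 : {m : Mon | (monomial m (1 : k) : Poly k) ∈ E}ᶜ =
      (fun p : Σ _ : ℕ, ℕ => mon p.1 p.2) ''
        ((Finset.range (xMin E)).sigma fun a => Finset.range (stair E a)) := by
    ext m
    rw [← mon_eta m, Set.mem_compl_iff, Set.mem_ofPred_eq, hE.mem_iff, not_le]
    simp only [Set.mem_image, Finset.mem_coe, Finset.mem_sigma, Finset.mem_range, mon_inj]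
    constructor
    · intro hm
      refine ⟨⟨m 0, m 1⟩, ⟨?_, hm⟩, rfl, rfl⟩
      by_contra hle
      dsimp only at hle
      have := hE.antitone (not_lt.1 hle)
      rw [hE.xMin_eq] at this
      omega
    · rintro ⟨⟨a, b⟩, ⟨-, hb⟩, rfl, rfl⟩
      exact hb
  rw [h1, Set.ncard_image_of_injective, Set.ncard_coe_finset, Finset.card_sigma]
  · simp
  · rintro ⟨a, b⟩ ⟨a', b'⟩ hab
    obtain ⟨rfl, rfl⟩ := mon_inj.1 hab
    rfl

end IsStaircase

end MonomialIdeal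

end GroebnerCell

namespace GroebnerCell

open MvPolynomial
open scoped MonomialOrder

/-! ### Leading ideals in terms of adapted families, and the radical condition. -/

section LeadingIdeal

variable {K : Type u} [Field K]

/-- An ideal has the leading monomials given by the staircase `h` if and only if it contains an
adapted family and no nonzero reduced polynomial. -/
theorem leadingIdeal_eq_iff {E : Ideal (Poly K)} (hmon : IsMonomialIdeal E) {h : ℕ → ℕ}
    (hh : Antitone h) (hE : ∀ a b, (monomial (mon a b) (1 : K) : Poly K) ∈ E ↔ h a ≤ b)
    (I : Ideal (Poly K)) : leadingIdeal I = E ↔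
      (∃ F, IsAdapted h F ∧ ∀ s, F s ∈ biIdeal I) ∧ NoReduced h (biIdeal I) := by
  constructor
  · rintro rfl
    simp only [monomial_mem_leadingIdeal_iff] at hE
    constructor
    · have hex : ∀ s, ∃ g ∈ biIdeal I, g.natDegree ≤ s ∧ (g.coeff s).Monic ∧
          (g.coeff s).natDegree = h s := fun s => by
        obtain ⟨f, hf, hf0, hle⟩ := (hE s (h s)).2 le_rfl
        rw [degree_eq_mon hf0, mon_le_mon] at hle
        obtain ⟨h1, h2⟩ := hle
        rw [← toBi_mem_biIdeal] at hf
        have hg0 : toBi f ≠ 0 := by rwa [Ne, EmbeddingLike.map_eq_zero_iff]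
        set g := toBi f
        have hc0 : g.leadingCoeff.leadingCoeff ≠ 0 := by
          rwa [Polynomial.leadingCoeff_ne_zero, Polynomial.leadingCoeff_ne_zero]
        have hm : (Polynomial.C g.leadingCoeff.leadingCoeff⁻¹ * g.leadingCoeff).Monic :=
          Polynomial.monic_C_mul_of_mul_leadingCoeff_eq_one (inv_mul_cancel₀ hc0)
        -- The leading monomial of `g` divides `x^s y^(h s)`; multiplying by the complementary
        -- powers of `x` and `y` and normalizing moves it exactly there.
        have hcoeff : (Polynomial.C (Polynomial.X ^ (h s - g.leadingCoeff.natDegree) *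
            Polynomial.C g.leadingCoeff.leadingCoeff⁻¹) *
              (Polynomial.X ^ (s - g.natDegree) * g)).coeff s =
            Polynomial.X ^ (h s - g.leadingCoeff.natDegree) *
              (Polynomial.C g.leadingCoeff.leadingCoeff⁻¹ * g.leadingCoeff) := by
          have hX := Polynomial.coeff_X_pow_mul g (s - g.natDegree) g.natDegree
          rw [Nat.add_sub_cancel' h1] at hX
          rw [Polynomial.coeff_C_mul, hX, Polynomial.coeff_natDegree, mul_assoc]
        refine ⟨Polynomial.C (Polynomial.X ^ (h s - g.leadingCoeff.natDegree) *
            Polynomial.C g.leadingCoeff.leadingCoeff⁻¹) * (Polynomial.X ^ (s - g.natDegree) * g),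
          Ideal.mul_mem_left _ _ (Ideal.mul_mem_left _ _ hf), ?_, ?_, ?_⟩
        · refine (Polynomial.natDegree_C_mul_le _ _).trans (Polynomial.natDegree_mul_le.trans ?_)
          rw [Polynomial.natDegree_X_pow]
          omega
        · rw [hcoeff]
          exact (Polynomial.monic_X_pow _).mul hm
        · rw [hcoeff, (Polynomial.monic_X_pow _).natDegree_mul hm, Polynomial.natDegree_X_pow,
            Polynomial.natDegree_C_mul (inv_ne_zero hc0)]
          omega
      choose F hF h1 h2 h3 using hex
      exact ⟨F, ⟨h1, h2, h3⟩, hF⟩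
    · intro r hr hred
      by_contra hne
      have hne' : toBi.symm r ≠ 0 := by rwa [Ne, EmbeddingLike.map_eq_zero_iff]
      have h1 := (hE r.natDegree r.leadingCoeff.natDegree).1 ⟨toBi.symm r, hr, hne', by
        rw [degree_eq_mon hne', RingEquiv.apply_symm_apply]⟩
      have h2 := hred r.natDegree
      rw [Polynomial.coeff_natDegree,
        Polynomial.degree_eq_natDegree (Polynomial.leadingCoeff_ne_zero.2 hne), Nat.cast_lt] at h2
      omega
  · rintro ⟨⟨F, hF, hFI⟩, hI⟩
    refine (isMonomialIdeal_leadingIdeal I).eq_of_monomial_mem_iff hmon fun m => ?_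
    rw [← mon_eta m, monomial_mem_leadingIdeal_iff, hE]
    constructor
    · rintro ⟨f, hf, hf0, hle⟩
      rw [degree_eq_mon hf0, mon_le_mon] at hle
      rw [← toBi_mem_biIdeal] at hf
      have hg0 : toBi f ≠ 0 := by rwa [Ne, EmbeddingLike.map_eq_zero_iff]
      set g := toBi f
      -- The top coefficient of `g` is a nonzero multiple of that of the adapted member of the same
      -- `x`-degree, so the leading monomial of `g` is on or above the staircase.
      obtain ⟨q, hq⟩ := hI.exists_eq_sum hF hFI hf (coeff_eq_zero_of_natDegree_succ_le g)
      have h1 : g.leadingCoeff = q g.natDegree * (F g.natDegree).coeff g.natDegree := by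
        have := congrArg (fun p => Polynomial.coeff p g.natDegree) hq
        simp only [hF.coeff_sum] at this
        exact this
      have h2 : q g.natDegree ≠ 0 := fun h0 => by
        rw [h0, zero_mul, Polynomial.leadingCoeff_eq_zero] at h1
        exact hg0 h1
      have h3 : h g.natDegree ≤ g.leadingCoeff.natDegree := by
        rw [h1, Polynomial.natDegree_mul h2 (hF.monic _).ne_zero, hF.natDegree_coeff]
        exact Nat.le_add_left _ _
      exact (hh hle.1).trans (h3.trans hle.2)
    · intro hle
      have hne : F (m 0) ≠ 0 := fun h0 => (hF.monic (m 0)).ne_zero (by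
        rw [h0, Polynomial.coeff_zero])
      have hne' : toBi.symm (F (m 0)) ≠ 0 := by rwa [Ne, EmbeddingLike.map_eq_zero_iff]
      refine ⟨toBi.symm (F (m 0)), hFI _, hne', ?_⟩
      have hnat : (F (m 0)).natDegree = m 0 :=
        Polynomial.natDegree_eq_of_le_of_coeff_ne_zero (hF.natDegree_le _) (hF.monic _).ne_zero
      rw [degree_eq_mon hne', RingEquiv.apply_symm_apply, mon_le_mon, Polynomial.leadingCoeff, hnat,
        hF.natDegree_coeff]
      exact ⟨le_rfl, hle⟩

theorem mem_span_X_iff {f : Poly K} :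
    f ∈ Ideal.span {(X 0 : Poly K), X 1} ↔ f.coeff 0 = 0 := by
  have h1 : ({(X 0 : Poly K), X 1} : Set (Poly K)) = X '' (Set.univ : Set (Fin 2)) := by
    ext g
    simp [Fin.exists_fin_two, eq_comm]
  rw [h1, mem_ideal_span_X_image]
  constructor
  · intro hf
    by_contra hne
    obtain ⟨i, -, hi⟩ := hf 0 (mem_support_iff.2 hne)
    exact hi rfl
  · intro hf m hm
    by_contra! hne
    have : m = 0 := Finsupp.ext fun i => hne i (Set.mem_univ i)
    rw [this, mem_support_iff] at hm
    exact hm hf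

/-- Once `x` and `y` are in the radical, an element with nonzero constant term would put a unit
there, contrary to `I ≠ ⊤`. -/
theorem radical_eq_span_iff {I : Ideal (Poly K)} (hI : I ≠ ⊤) :
    I.radical = Ideal.span {X 0, X 1} ↔ X 1 ∈ I.radical ∧ X 0 ∈ I.radical := by
  constructor
  · intro h
    rw [h]
    exact ⟨Ideal.subset_span (by simp), Ideal.subset_span (by simp)⟩
  · rintro ⟨h1, h0⟩
    have hle : Ideal.span {(X 0 : Poly K), X 1} ≤ I.radical := by
      rw [Ideal.span_le]
      rintro f (rfl | rfl)
      exacts [h0, h1]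
    refine le_antisymm (fun f hf => ?_) hle
    rw [mem_span_X_iff]
    by_contra hne
    have h2 : f - C (f.coeff 0) ∈ I.radical := hle (mem_span_X_iff.2 (by simp))
    have h3 : C (f.coeff 0) ∈ I.radical := by
      have := I.radical.sub_mem hf h2
      rwa [sub_sub_cancel] at this
    exact hI (Ideal.radical_eq_top.1 (Ideal.eq_top_of_isUnit_mem _ h3
      ((isUnit_iff_ne_zero.2 hne).map C)))

end LeadingIdeal

/-! ### Coordinates of the cell as coefficients of corner remainders. -/

section Coordinates

variable {k : Type u} [Field k] {E : Ideal (Poly k)} {A : Type*} [CommRing A]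

theorem IsStaircase.minimal_iff (hE : IsStaircase E) {s b : ℕ} :
    Minimal (fun a : Mon => (monomial a (1 : k) : Poly k) ∈ E) (mon s b) ↔
      b = stair E s ∧ base (stair E) s = s := by
  constructor
  · intro hm
    have hb := (hE.mem_iff s b).1 hm.1
    have h1 := hm.2 (y := mon s (stair E s)) ((hE.mem_iff _ _).2 le_rfl)
      (mon_le_mon.2 ⟨le_rfl, hb⟩)
    have h2 := hm.2 (y := mon (base (stair E) s) (stair E s))
      ((hE.mem_iff _ _).2 (apply_base _ s).le) (mon_le_mon.2 ⟨base_le _ rfl, hb⟩)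
    exact ⟨le_antisymm (mon_le_mon.1 h1).2 hb,
      le_antisymm (base_le _ rfl) (mon_le_mon.1 h2).1⟩
  · rintro ⟨rfl, hs⟩
    refine ⟨(hE.mem_iff _ _).2 le_rfl, fun m hm hle => ?_⟩
    rw [← mon_eta m] at hm hle ⊢
    rw [hE.mem_iff] at hm
    rw [mon_le_mon] at hle ⊢
    have h1 := hE.antitone hle.1
    have h2 := base_le (stair E) (s := s) (l := m 0) (by omega)
    exact ⟨by omega, by omega⟩

theorem IsStaircase.tail_iff (hE : IsStaircase E) {s a b : ℕ} :
    ((monomial (mon a b) (1 : k) : Poly k) ∉ E ∧ mon a b ≺[lexOrder] mon s (stair E s)) ↔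
      a ≤ s ∧ b < stair E a := by
  rw [hE.mem_iff, lex_lt_mon_iff]
  constructor
  · rintro ⟨h1, h2 | ⟨rfl, h2⟩⟩ <;> omega
  · rintro ⟨h1, h2⟩
    rcases h1.lt_or_eq with h1 | rfl <;> omega

theorem IsStaircase.exists_eq_mon (hE : IsStaircase E) (m : MinGen E) :
    m.1 = mon (m.1 0) (stair E (m.1 0)) ∧ base (stair E) (m.1 0) = m.1 0 := by
  have h1 := m.2
  rw [← mon_eta m.1, hE.minimal_iff] at h1
  refine ⟨?_, h1.2⟩
  conv_lhs => rw [← mon_eta m.1, h1.1]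

theorem IsStaircase.tail_iff' (hE : IsStaircase E) (m : MinGen E) (a : Mon) :
    ((monomial a (1 : k) : Poly k) ∉ E ∧ a ≺[lexOrder] m.1) ↔
      a 0 ≤ m.1 0 ∧ a 1 < stair E (a 0) := by
  have h1 := hE.tail_iff (s := m.1 0) (a := a 0) (b := a 1)
  rwa [mon_eta, ← (hE.exists_eq_mon m).1] at h1

open Classical in
/-- The coordinate of `c` belonging to the monomials `x ^ s * y ^ stair E s` and `x ^ a * y ^ b`. -/
noncomputable def coordExt (c : Coord E → A) (s a b : ℕ) : A :=
  if H : Minimal (fun a : Mon => (monomial a (1 : k) : Poly k) ∈ E) (mon s (stair E s)) ∧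
      ((monomial (mon a b) (1 : k) : Poly k) ∉ E ∧ mon a b ≺[lexOrder] mon s (stair E s)) then
    c ⟨⟨_, H.1⟩, ⟨_, H.2⟩⟩
  else 0

/-- The polynomial with the coefficients `c` belonging to the corner `x ^ s * y ^ stair E s`. -/
noncomputable def tailPoly (c : Coord E → A) (s : ℕ) : Polynomial (Polynomial A) :=
  ∑ a ∈ Finset.range (s + 1), ∑ b ∈ Finset.range (stair E a),
    Polynomial.monomial a (Polynomial.monomial b (coordExt c s a b))

/-- The coefficients of the normal forms of the corners. -/
noncomputable def coordOf (E : Ideal (Poly k)) (F : ℕ → Polynomial (Polynomial A)) :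
    Coord E → A :=
  fun p => ((cornerTail (stair E) F (p.1.1 0)).coeff (p.2.1 0)).coeff (p.2.1 1)

theorem coeff_tailPoly (c : Coord E → A) (s a b : ℕ) : ((tailPoly c s).coeff a).coeff b =
    if a ≤ s ∧ b < stair E a then coordExt c s a b else 0 := by
  rw [tailPoly, Polynomial.finsetSum_coeff]
  simp only [← map_sum, Polynomial.coeff_monomial]
  rw [Finset.sum_ite_eq']
  simp only [Finset.mem_range, Nat.lt_succ_iff]
  by_cases ha : a ≤ s
  · rw [if_pos ha, Polynomial.finsetSum_coeff]
    simp only [Polynomial.coeff_monomial]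
    rw [Finset.sum_ite_eq']
    simp only [Finset.mem_range, ha, true_and]
  · rw [if_neg ha, if_neg fun h => ha h.1, Polynomial.coeff_zero]

theorem isReduced_tailPoly (c : Coord E → A) (s : ℕ) : IsReduced (stair E) (tailPoly c s) :=
  fun a => by
    rw [Polynomial.degree_lt_iff_coeff_zero]
    intro b hb
    rw [coeff_tailPoly, if_neg fun h => absurd h.2 (not_lt.2 hb)]

theorem coeff_tailPoly_eq_zero (c : Coord E → A) (s : ℕ) :
    ∀ a, s + 1 ≤ a → (tailPoly c s).coeff a = 0 := fun a ha => by
  ext b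
  rw [coeff_tailPoly, if_neg (by omega), Polynomial.coeff_zero]

theorem tailPoly_map {A' : Type*} [CommRing A'] (φ : A →+* A') (c : Coord E → A) (s : ℕ) :
    (tailPoly c s).map (Polynomial.mapRingHom φ) = tailPoly (fun p => φ (c p)) s := by
  ext a b
  rw [Polynomial.coeff_map, Polynomial.coe_mapRingHom, Polynomial.coeff_map, coeff_tailPoly,
    coeff_tailPoly, coordExt, coordExt]
  split_ifs <;> simp

theorem coordExt_of_mem (hE : IsStaircase E) (c : Coord E → A) (p : Coord E) :
    coordExt c (p.1.1 0) (p.2.1 0) (p.2.1 1) = c p := by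
  obtain ⟨⟨m, hm⟩, ⟨a, ha⟩⟩ := p
  have hmm := (hE.exists_eq_mon ⟨m, hm⟩).1
  have haa := (mon_eta a).symm
  dsimp only at hmm ⊢
  generalize m 0 = s at *
  generalize a 0 = a0 at *
  generalize a 1 = a1 at *
  subst hmm haa
  rw [coordExt, dif_pos ⟨hm, ha⟩]

theorem coord_eq_of_tailPoly_eq (hE : IsStaircase E) {c c' : Coord E → A}
    (hcc' : ∀ s, base (stair E) s = s → tailPoly c s = tailPoly c' s) : c = c' := by
  funext p
  have h1 := hE.exists_eq_mon p.1
  have h2 := (hE.tail_iff' p.1 p.2.1).1 p.2.2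
  have h3 := congrArg (fun f => (Polynomial.coeff f (p.2.1 0)).coeff (p.2.1 1)) (hcc' _ h1.2)
  simp only [coeff_tailPoly, if_pos h2, coordExt_of_mem hE] at h3
  exact h3

theorem isAdapted_stairFamily_tailPoly [Nontrivial A] (c : Coord E → A) :
    IsAdapted (stair E) (stairFamily (stair E) (tailPoly c)) :=
  isAdapted_stairFamily fun s _ => ⟨isReduced_tailPoly c s, coeff_tailPoly_eq_zero c s⟩

/-- The remainder of a corner is reduced and of `x`-degree at most `s`, so each of its coefficients
that can be nonzero is one of the coordinates. -/
theorem tailPoly_coordOf [Nontrivial A] (hE : IsStaircase E) {F : ℕ → Polynomial (Polynomial A)}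
    (hF : IsAdapted (stair E) F) {s : ℕ} (hs : base (stair E) s = s) :
    tailPoly (coordOf E F) s = cornerTail (stair E) F s := by
  have hdiv := hF.isDivision_cornerTail s
  ext a b
  rw [coeff_tailPoly]
  split_ifs with hab
  · rw [coordExt, dif_pos ⟨hE.minimal_iff.2 ⟨rfl, hs⟩, hE.tail_iff.2 hab⟩]
    change ((cornerTail (stair E) F (mon s (stair E s) 0)).coeff (mon a b 0)).coeff
      (mon a b 1) = _
    simp only [mon_apply_zero, mon_apply_one]
  · by_cases ha : a ≤ s
    · exact ((Polynomial.degree_lt_iff_coeff_zero _ _).1 (hdiv.reduced a) b (by omega)).symm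
    · rw [hdiv.coeff_eq_zero a (by omega), Polynomial.coeff_zero]

theorem coordOf_map [Nontrivial A] {A' : Type*} [CommRing A'] [Nontrivial A'] (φ : A →+* A')
    {F : ℕ → Polynomial (Polynomial A)} (hF : IsAdapted (stair E) F) (p : Coord E) :
    coordOf E (fun s => (F s).map (Polynomial.mapRingHom φ)) p = φ (coordOf E F p) := by
  rw [coordOf, hF.cornerTail_map φ, Polynomial.coeff_map, Polynomial.coe_mapRingHom,
    Polynomial.coeff_map, coordOf]

variable {K : Type u} [Field K]

theorem toBi_cellPoly (hmon : IsMonomialIdeal E) (hfin : Module.Finite k (Poly k ⧸ E))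
    (hE : IsStaircase E) (c : Coord E → K) (m : MinGen E) :
    toBi (cellPoly E c m) = corner (stair E) (m.1 0) - tailPoly c (m.1 0) := by
  have := finite_tail hmon hfin m.1
  have := Fintype.ofFinite (Tail E m.1)
  obtain ⟨hm, -⟩ := hE.exists_eq_mon m
  rw [cellPoly, finsum_eq_sum_of_fintype, map_sub]
  refine congrArg₂ (· - ·) ?_ ?_
  · rw [toBi_monomial, corner, ← Polynomial.X_pow_eq_monomial]
    conv_lhs => rw [hm]
    simp only [mon_apply_zero, mon_apply_one]
  · ext a b
    rw [coeff_toBi, coeff_sum, coeff_tailPoly]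
    simp only [coeff_monomial]
    split_ifs with hab
    · rw [← hE.tail_iff, ← hm] at hab
      refine (Finset.sum_eq_single (⟨mon a b, hab⟩ : Tail E m.1) ?_ ?_).trans ?_
      · intro x _ hx
        rw [if_neg fun h => hx (Subtype.ext h)]
      · exact fun h => absurd (Finset.mem_univ (α := Tail E m.1) _) h
      · have h1 := coordExt_of_mem hE c ⟨m, ⟨mon a b, hab⟩⟩
        simp only [mon_apply_zero, mon_apply_one] at h1
        rw [if_pos rfl, h1]
    · refine Finset.sum_eq_zero fun x _ => if_neg fun h => hab ?_
      have h2 := (hE.tail_iff' m x.1).1 x.2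
      rwa [h, mon_apply_zero, mon_apply_one] at h2

theorem corner_sub_tailPoly_mem (hmon : IsMonomialIdeal E) (hfin : Module.Finite k (Poly k ⧸ E))
    (hE : IsStaircase E) (c : Coord E → K) {s : ℕ} (hs : base (stair E) s = s) :
    corner (stair E) s - tailPoly c s ∈ biIdeal (cellIdeal E c) := by
  have h1 := toBi_cellPoly hmon hfin hE c ⟨_, hE.minimal_iff.2 ⟨rfl, hs⟩⟩
  simp only [mon_apply_zero] at h1
  rw [← h1, toBi_mem_biIdeal]
  exact Ideal.subset_span (Set.mem_range_self _)

/-- The `x`-multiples of the corner polynomials form an adapted family in `I`; as `I` has no reduced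
elements, they generate it. -/
theorem cellIdeal_eq (hmon : IsMonomialIdeal E) (hfin : Module.Finite k (Poly k ⧸ E))
    (hE : IsStaircase E) {c : Coord E → K} {I : Ideal (Poly K)}
    (hI : NoReduced (stair E) (biIdeal I))
    (hc : ∀ s, base (stair E) s = s → corner (stair E) s - tailPoly c s ∈ biIdeal I) :
    cellIdeal E c = I := by
  refine le_antisymm (Ideal.span_le.2 ?_) fun f hf => ?_
  · rintro _ ⟨m, rfl⟩
    rw [SetLike.mem_coe, ← toBi_mem_biIdeal, toBi_cellPoly hmon hfin hE]
    exact hc _ (hE.exists_eq_mon m).2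
  · rw [← toBi_mem_biIdeal] at hf ⊢
    rw [← hI.span_eq (isAdapted_stairFamily_tailPoly c) (stairFamily_mem hc)] at hf
    refine Ideal.span_le.2 ?_ hf
    rintro _ ⟨s, rfl⟩
    exact stairFamily_mem (fun s hs => corner_sub_tailPoly_mem hmon hfin hE c hs) s

/-- Two tails for the same corner differ by a reduced element of `J`. -/
theorem coord_unique (hE : IsStaircase E) {c c' : Coord E → K}
    {J : Ideal (Polynomial (Polynomial K))} (hJ : NoReduced (stair E) J)
    (hc : ∀ s, base (stair E) s = s → corner (stair E) s - tailPoly c s ∈ J)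
    (hc' : ∀ s, base (stair E) s = s → corner (stair E) s - tailPoly c' s ∈ J) : c = c' :=
  coord_eq_of_tailPoly_eq hE fun s hs => by
    refine sub_eq_zero.1 (hJ _ ?_ ((isReduced_tailPoly c s).sub (isReduced_tailPoly c' s)))
    have := J.sub_mem (hc' s hs) (hc s hs)
    rwa [sub_sub_sub_cancel_left] at this

end Coordinates

end GroebnerCell

namespace GroebnerCell

/-! ### Entries of the syzygy matrix as free coordinates, and their number. -/

section Data

variable {k : Type u} [Field k] {E : Ideal (Poly k)} {A : Type*} [CommRing A]

/-- The indices `(s, l, e)` of the coefficients of `y ^ e` in the entries `(s, l)` of the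
syzygy matrix. -/
noncomputable def syzIndex (E : Ideal (Poly k)) : Finset (Σ _ : ℕ, ℕ × ℕ) :=
  (Finset.range (xMin E)).sigma fun s =>
    Finset.range (s + 2) ×ˢ Finset.range (stair E s - stair E (s + 1))

theorem IsStaircase.mem_syzIndex (hE : IsStaircase E) {s l e : ℕ} :
    (⟨s, (l, e)⟩ : Σ _ : ℕ, ℕ × ℕ) ∈ syzIndex E ↔
      l ≤ s + 1 ∧ e < stair E s - stair E (s + 1) := by
  simp only [syzIndex, Finset.mem_sigma, Finset.mem_product, Finset.mem_range]
  refine ⟨fun h => ⟨by omega, h.2.2⟩, fun h => ⟨?_, by omega, h.2⟩⟩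
  by_contra hs
  have := hE.antitone (not_lt.1 hs)
  rw [hE.xMin_eq] at this
  omega

open Classical in
/-- The syzygy matrix with coefficients `z`. -/
noncomputable def dataOf (z : Fin (syzIndex E).card → A) (s l : ℕ) : Polynomial A :=
  ∑ e ∈ Finset.range (stair E s - stair E (s + 1)), Polynomial.monomial e
    (if H : (⟨s, (l, e)⟩ : Σ _ : ℕ, ℕ × ℕ) ∈ syzIndex E then
      z ((syzIndex E).equivFin ⟨_, H⟩) else 0)

/-- The coefficients of the syzygy matrix `N`. -/
noncomputable def coeffData (E : Ideal (Poly k)) (N : ℕ → ℕ → Polynomial A)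
    (j : Fin (syzIndex E).card) : A :=
  (N ((syzIndex E).equivFin.symm j).1.1 ((syzIndex E).equivFin.symm j).1.2.1).coeff
    ((syzIndex E).equivFin.symm j).1.2.2

theorem coeff_dataOf_of_mem (z : Fin (syzIndex E).card → A) {s l e : ℕ}
    (H : (⟨s, (l, e)⟩ : Σ _ : ℕ, ℕ × ℕ) ∈ syzIndex E) :
    (dataOf z s l).coeff e = z ((syzIndex E).equivFin ⟨_, H⟩) := by
  have he : e < stair E s - stair E (s + 1) := by
    simp only [syzIndex, Finset.mem_sigma, Finset.mem_product, Finset.mem_range] at H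
    exact H.2.2
  simp only [dataOf, Polynomial.finsetSum_coeff, Polynomial.coeff_monomial]
  rw [Finset.sum_ite_eq', if_pos (Finset.mem_range.2 he), dif_pos H]

theorem degree_dataOf_lt (z : Fin (syzIndex E).card → A) (s l : ℕ) :
    (dataOf z s l).degree < (stair E s - stair E (s + 1) : ℕ) := by
  rw [Polynomial.degree_lt_iff_coeff_zero]
  intro e he
  simp only [dataOf, Polynomial.finsetSum_coeff, Polynomial.coeff_monomial]
  rw [Finset.sum_ite_eq', if_neg fun h => absurd (Finset.mem_range.1 h) (not_lt.2 he)]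

theorem dataOf_map {A' : Type*} [CommRing A'] (φ : A →+* A') (z : Fin (syzIndex E).card → A)
    (s l : ℕ) : (dataOf z s l).map φ = dataOf (fun j => φ (z j)) s l := by
  simp only [dataOf, Polynomial.map_sum, Polynomial.map_monomial]
  refine Finset.sum_congr rfl fun e _ => ?_
  split_ifs <;> simp

theorem coeff_dataOf (z : Fin (syzIndex E).card → A) (j : Fin (syzIndex E).card) :
    (dataOf z ((syzIndex E).equivFin.symm j).1.1 ((syzIndex E).equivFin.symm j).1.2.1).coeff
      ((syzIndex E).equivFin.symm j).1.2.2 = z j := by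
  rw [coeff_dataOf_of_mem z ((syzIndex E).equivFin.symm j).2]
  congr 1
  exact (syzIndex E).equivFin.apply_symm_apply j

theorem dataOf_coeffData (hE : IsStaircase E) (N : ℕ → ℕ → Polynomial A) {s l : ℕ}
    (hl : l ≤ s + 1) (hN : (N s l).degree < (stair E s - stair E (s + 1) : ℕ)) :
    dataOf (coeffData E N) s l = N s l := by
  ext e
  by_cases he : e < stair E s - stair E (s + 1)
  · rw [coeff_dataOf_of_mem _ (hE.mem_syzIndex.2 ⟨hl, he⟩), coeffData, Equiv.symm_apply_apply]
  · rw [(Polynomial.degree_lt_iff_coeff_zero _ _).1 hN e (not_lt.1 he),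
      (Polynomial.degree_lt_iff_coeff_zero _ _).1 (degree_dataOf_lt _ s l) e (not_lt.1 he)]

open Classical in
/-- The coordinates whose index satisfies `p`. -/
noncomputable def coordSubset (E : Ideal (Poly k)) (p : ℕ → ℕ → ℕ → Prop) :
    Finset (Fin (syzIndex E).card) :=
  Finset.univ.filter fun j => p ((syzIndex E).equivFin.symm j).1.1
    ((syzIndex E).equivFin.symm j).1.2.1 ((syzIndex E).equivFin.symm j).1.2.2

open Classical in
theorem card_coordSubset (p : ℕ → ℕ → ℕ → Prop) : (coordSubset E p).card =
    ((syzIndex E).filter fun i => p i.1 i.2.1 i.2.2).card := by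
  refine Finset.card_bij (fun j _ => ((syzIndex E).equivFin.symm j).1) (fun j hj => ?_)
    (fun j _ j' _ h => ?_) fun i hi => ?_
  · exact Finset.mem_filter.2 ⟨((syzIndex E).equivFin.symm j).2, (Finset.mem_filter.1 hj).2⟩
  · exact (syzIndex E).equivFin.symm.injective (Subtype.ext h)
  · obtain ⟨h1, h2⟩ := Finset.mem_filter.1 hi
    refine ⟨(syzIndex E).equivFin ⟨i, h1⟩, Finset.mem_filter.2 ⟨Finset.mem_univ _, ?_⟩, ?_⟩
    · rwa [Equiv.symm_apply_apply]
    · rw [Equiv.symm_apply_apply]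

theorem forall_notMem_coordSubset_iff (hE : IsStaircase E) (p : ℕ → ℕ → ℕ → Prop)
    (z : Fin (syzIndex E).card → A) : (∀ j ∉ coordSubset E p, z j = 0) ↔
      ∀ s l, l ≤ s + 1 → ∀ e, (dataOf z s l).coeff e ≠ 0 → p s l e := by
  classical
  constructor
  · intro hz s l hl e he
    have hlt : e < stair E s - stair E (s + 1) := by
      by_contra hge
      exact he ((Polynomial.degree_lt_iff_coeff_zero _ _).1 (degree_dataOf_lt z s l) e
        (not_lt.1 hge))
    have hm := hE.mem_syzIndex.2 ⟨hl, hlt⟩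
    rw [coeff_dataOf_of_mem z hm] at he
    by_contra hp
    refine he (hz _ fun hj => hp ?_)
    have := (Finset.mem_filter.1 hj).2
    rwa [Equiv.symm_apply_apply] at this
  · intro hz j hj
    by_contra hne
    rw [← coeff_dataOf z j] at hne
    exact hj (Finset.mem_filter.2 ⟨Finset.mem_univ _,
      hz _ _ (hE.mem_syzIndex.1 ((syzIndex E).equivFin.symm j).2).1 _ hne⟩)

theorem sum_mul_sub_of_antitone {h : ℕ → ℕ} (hh : Antitone h) (t : ℕ) :
    ∑ s ∈ Finset.range t, (s + 1) * (h s - h (s + 1)) + t * h t = ∑ s ∈ Finset.range t, h s := by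
  induction t with
  | zero => simp
  | succ t ih =>
    rw [Finset.sum_range_succ, Finset.sum_range_succ, ← ih, add_assoc, ← mul_add,
      Nat.sub_add_cancel (hh t.le_succ)]
    ring

/-- Pairs off the diagonal. -/
def OffDiag (s l _e : ℕ) : Prop := l ≠ s + 1

/-- The coefficients off the diagonal which do not contribute to `x ∈ √I`. -/
def NotUnipotent (h : ℕ → ℕ) (s l e : ℕ) : Prop := l ≠ s + 1 ∧ ¬(e = 0 ∧ h l = h s)

/-- The coefficients which are compatible with homogeneity. -/
def HomogIndex (h : ℕ → ℕ) (s l e : ℕ) : Prop := e + h l + l = h s + s + 1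

namespace IsStaircase

theorem sum_range_eq (hE : IsStaircase E) :
    ∑ s ∈ Finset.range (xMin E), (s + 1) * (stair E s - stair E (s + 1)) =
      ∑ s ∈ Finset.range (xMin E), stair E s := by
  rw [← sum_mul_sub_of_antitone hE.antitone, hE.xMin_eq, mul_zero, add_zero]

/-- Row `s` contributes `s + 2` entries: `s + 1` of them give the area under the staircase by Abel
summation, and the last ones telescope to `stair E 0`. -/
theorem card_syzIndex (hE : IsStaircase E) :
    (syzIndex E).card = ∑ s ∈ Finset.range (xMin E), stair E s + stair E 0 := by
  have h1 := sum_Ico_sub_of_antitone hE.antitone (Nat.zero_le (xMin E))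
  rw [hE.xMin_eq, Nat.sub_zero, ← Finset.range_eq_Ico] at h1
  rw [syzIndex, Finset.card_sigma, ← hE.sum_range_eq, ← h1, ← Finset.sum_add_distrib]
  refine Finset.sum_congr rfl fun s _ => ?_
  rw [Finset.card_product, Finset.card_range, Finset.card_range]
  ring

theorem card_offDiag (hE : IsStaircase E) :
    (coordSubset E OffDiag).card = ∑ s ∈ Finset.range (xMin E), stair E s := by
  classical
  rw [card_coordSubset, ← hE.sum_range_eq]
  have h1 : ((syzIndex E).filter fun i => OffDiag i.1 i.2.1 i.2.2) =
      (Finset.range (xMin E)).sigma fun s =>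
        Finset.range (s + 1) ×ˢ Finset.range (stair E s - stair E (s + 1)) := by
    ext ⟨s, l, e⟩
    rw [Finset.mem_filter]
    simp only [syzIndex, OffDiag, Finset.mem_sigma, Finset.mem_product,
      Finset.mem_range]
    omega
  rw [h1, Finset.card_sigma]
  simp only [Finset.card_product, Finset.card_range]

theorem exists_last (hE : IsStaircase E) {l : ℕ} (hl : l < xMin E) :
    ∃ s, l ≤ s ∧ stair E l = stair E s ∧ stair E (s + 1) < stair E s := by
  have hex : ∃ s, stair E (l + s + 1) < stair E l := by
    refine ⟨xMin E - l, ?_⟩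
    have h1 := hE.antitone (show xMin E ≤ l + (xMin E - l) + 1 by omega)
    have h2 := hE.pos l hl
    rw [hE.xMin_eq] at h1
    omega
  classical
  have h1 := Nat.find_spec hex
  have h2 : stair E (l + Nat.find hex) = stair E l := by
    rcases Nat.eq_zero_or_pos (Nat.find hex) with h0 | h0
    · rw [h0, add_zero]
    · have h3 := Nat.find_min hex (Nat.sub_lt h0 one_pos)
      rw [show l + (Nat.find hex - 1) + 1 = l + Nat.find hex by omega, not_lt] at h3
      exact le_antisymm (hE.antitone (Nat.le_add_right _ _)) h3
  exact ⟨l + Nat.find hex, Nat.le_add_right _ _, h2.symm, by rwa [h2]⟩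

/-- The omitted triples `(s, l, 0)` project bijectively onto `l < xMin E`: a nonempty range for `e`
needs a descent right after `s`, so `s` must be the last index on the plateau of `l`. -/
theorem card_notUnipotent (hE : IsStaircase E) :
    (coordSubset E (NotUnipotent (stair E))).card + xMin E =
      ∑ s ∈ Finset.range (xMin E), stair E s := by
  classical
  rw [← hE.card_offDiag, card_coordSubset, card_coordSubset,
    ← Finset.card_filter_add_card_filter_not (fun i => ¬(i.2.2 = 0 ∧ stair E i.2.1 = stair E i.1))
      (s := (syzIndex E).filter fun i => OffDiag i.1 i.2.1 i.2.2), Finset.filter_filter]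
  refine congrArg₂ (· + ·) (congrArg Finset.card (Finset.ext fun i => ?_)) ?_
  · rw [Finset.mem_filter, Finset.mem_filter]
    rfl
  conv_lhs => rw [← Finset.card_range (xMin E)]
  symm
  refine Finset.card_bij (fun i _ => i.2.1) ?_ ?_ ?_
  · rintro ⟨s, l, e⟩ hi
    rw [Finset.mem_filter, Finset.mem_filter] at hi
    simp only [syzIndex, OffDiag, Finset.mem_sigma, Finset.mem_product, Finset.mem_range] at hi
    rw [Finset.mem_range]
    dsimp only
    omega
  · rintro ⟨s, l, e⟩ hi ⟨s', l', e'⟩ hi' hll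
    rw [Finset.mem_filter, Finset.mem_filter] at hi hi'
    simp only [syzIndex, OffDiag, Finset.mem_sigma, Finset.mem_product, Finset.mem_range,
      not_not] at hi hi'
    dsimp only at hll
    subst hll
    obtain ⟨⟨⟨-, -, h1⟩, -⟩, h2, h3⟩ := hi
    obtain ⟨⟨⟨-, -, h1'⟩, -⟩, h2', h3'⟩ := hi'
    have hs : s = s' := by
      rcases lt_trichotomy s s' with h | h | h
      · have := hE.antitone (show s + 1 ≤ s' from h)
        omega
      · exact h
      · have := hE.antitone (show s' + 1 ≤ s from h)
        omega
    subst hs h2 h2'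
    rfl
  · intro l hl
    rw [Finset.mem_range] at hl
    obtain ⟨s, h1, h2, h3⟩ := hE.exists_last hl
    refine ⟨⟨s, l, 0⟩, ?_, rfl⟩
    rw [Finset.mem_filter, Finset.mem_filter, hE.mem_syzIndex, OffDiag, not_not]
    exact ⟨⟨⟨by omega, by omega⟩, by dsimp only; omega⟩, rfl, h2⟩

/-- Under `i = t - l + 1` and `j = t - s` the exponent forced by homogeneity is `u_{ij}` and the
degree bound is `d_j`. The entries with `l = s + 1` drop out, which corresponds to `j < i`. -/
theorem card_homogIndex (hE : IsStaircase E) :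
    (coordSubset E (HomogIndex (stair E))).card = (indexSet E).ncard := by
  classical
  rw [card_coordSubset]
  have h1 : indexSet E = (fun i : Σ _ : ℕ, ℕ × ℕ => (xMin E - i.2.1 + 1, xMin E - i.1)) ''
      ((syzIndex E).filter fun i => HomogIndex (stair E) i.1 i.2.1 i.2.2) := by
    ext ⟨i, j⟩
    simp only [Set.mem_image, Finset.mem_coe, Finset.mem_filter, Prod.mk.injEq]
    constructor
    · rintro ⟨h1, h2, h3, h4, h5⟩
      dsimp only at h1 h2 h3 h4 h5
      simp only [degMatrix, dSeq, mSeq_eq] at h4 h5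
      rw [show xMin E - (j - 1) = xMin E - j + 1 by omega] at h5
      refine ⟨⟨xMin E - j, xMin E - (i - 1), (((stair E (xMin E - j) : ℤ) -
        stair E (xMin E - (i - 1)) + i - j).toNat)⟩, ⟨?_, ?_⟩, ?_, ?_⟩
      · rw [hE.mem_syzIndex]
        omega
      · simp only [HomogIndex]
        omega
      · dsimp only
        omega
      · dsimp only
        omega
    · rintro ⟨⟨s, l, e⟩, ⟨h1, h2⟩, rfl, rfl⟩
      have hs : s < xMin E := by
        rw [syzIndex, Finset.mem_sigma, Finset.mem_range] at h1
        exact h1.1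
      rw [hE.mem_syzIndex] at h1
      simp only [HomogIndex] at h2
      have hls : l ≤ s := by
        by_contra hne
        obtain rfl : l = s + 1 := by omega
        omega
      simp only [indexSet, degMatrix, dSeq, mSeq_eq, Set.mem_ofPred_eq]
      rw [show xMin E - (xMin E - s) = s by omega,
        show xMin E - (xMin E - l + 1 - 1) = l by omega,
        show xMin E - (xMin E - s - 1) = s + 1 by omega]
      omega
  rw [h1, Set.InjOn.ncard_image, Set.ncard_coe_finset]
  rintro ⟨s, l, e⟩ hi ⟨s', l', e'⟩ hi' hii
  rw [Finset.mem_coe, Finset.mem_filter, hE.mem_syzIndex] at hi hi'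
  simp only [HomogIndex] at hi hi'
  simp only [Prod.mk.injEq] at hii
  have hs : ∀ {s l e : ℕ}, l ≤ s + 1 ∧ e < stair E s - stair E (s + 1) →
      e + stair E l + l = stair E s + s + 1 → s < xMin E ∧ l ≤ s := fun {s l e} h1 h2 => by
    have h3 := h1
    rw [← hE.mem_syzIndex, syzIndex, Finset.mem_sigma, Finset.mem_range] at h3
    refine ⟨h3.1, ?_⟩
    by_contra hne
    obtain rfl : l = s + 1 := by omega
    omega
  have h2 := hs hi.1 hi.2
  have h2' := hs hi'.1 hi'.2
  obtain rfl : s = s' := by omega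
  obtain rfl : l = l' := by omega
  obtain rfl : e = e' := by omega
  rfl

end IsStaircase

end Data

end GroebnerCell

namespace GroebnerCell

/-! ### The polynomial parametrization, its inverse, and the three coordinate subspaces. -/

section Parametrization

variable {k : Type u} [Field k] {E : Ideal (Poly k)}

theorem IsStaircase.isCanonical (hE : IsStaircase E) {A : Type*} [CommRing A] [Nontrivial A]
    (z : Fin (syzIndex E).card → A) :
    IsCanonical (stair E) (syzFamily (stair E) (xMin E) (dataOf z)) (dataOf z) :=
  isCanonical_syzFamily hE.antitone hE.xMin_eq fun s l _ => degree_dataOf_lt z s l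

/-- The polynomials parametrizing the cell. -/
noncomputable def cellParam (E : Ideal (Poly k)) :
    Coord E → MvPolynomial (Fin (syzIndex E).card) k :=
  coordOf E (syzFamily (stair E) (xMin E) (dataOf MvPolynomial.X))

/-- The polynomials computing the parameters of a point of the cell. -/
noncomputable def cellParamInv (E : Ideal (Poly k)) :
    Fin (syzIndex E).card → MvPolynomial (Coord E) k :=
  coeffData E (canonData (stair E) (stairFamily (stair E) (tailPoly MvPolynomial.X)))

variable {K : Type u} [Field K] [Algebra k K]

/-- Evaluation at `z` is a ring map, so it carries the construction with indeterminate entries to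
the construction over `K`. -/
theorem polyMap_cellParam (hE : IsStaircase E) (z : Fin (syzIndex E).card → K) :
    polyMap (cellParam E) K z = coordOf E (syzFamily (stair E) (xMin E) (dataOf z)) := by
  funext p
  have h1 := coordOf_map (MvPolynomial.aeval (R := k) z : _ →ₐ[k] K).toRingHom
    (hE.isCanonical MvPolynomial.X).adapted p
  have h2 : (fun j : Fin (syzIndex E).card => (MvPolynomial.aeval (R := k) z : _ →ₐ[k] K).toRingHom
      (MvPolynomial.X j)) = z := funext fun j => MvPolynomial.aeval_X z j
  simp only [syzFamily_map, dataOf_map, h2] at h1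
  exact h1.symm

theorem polyMap_cellParamInv (hE : IsStaircase E) (c : Coord E → K) :
    polyMap (cellParamInv E) K c =
      coeffData E (canonData (stair E) (stairFamily (stair E) (tailPoly c))) := by
  funext j
  have h1 := (isAdapted_stairFamily_tailPoly (E := E) (MvPolynomial.X (R := k))).canonData_map
    (MvPolynomial.aeval (R := k) c : _ →ₐ[k] K).toRingHom hE.antitone
  have h2 : (fun p : Coord E => (MvPolynomial.aeval (R := k) c : _ →ₐ[k] K).toRingHom
      (MvPolynomial.X p)) = c := funext fun p => MvPolynomial.aeval_X c p
  simp only [stairFamily_map, tailPoly_map, h2] at h1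
  rw [coeffData, h1, Polynomial.coeff_map]
  rfl

theorem corner_sub_tailPoly_mem_span (hE : IsStaircase E) (z : Fin (syzIndex E).card → K)
    {s : ℕ} (hs : base (stair E) s = s) :
    corner (stair E) s - tailPoly (polyMap (cellParam E) K z) s ∈
      Ideal.span (Set.range (syzFamily (stair E) (xMin E) (dataOf z))) := by
  rw [polyMap_cellParam hE, tailPoly_coordOf hE (hE.isCanonical z).adapted hs]
  exact (hE.isCanonical z).adapted.corner_sub_mem IsCanonical.mem_span s

theorem biIdeal_cellIdeal (hmon : IsMonomialIdeal E) (hfin : Module.Finite k (Poly k ⧸ E))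
    (hE : IsStaircase E) (z : Fin (syzIndex E).card → K) :
    biIdeal (cellIdeal E (polyMap (cellParam E) K z)) =
      Ideal.span (Set.range (syzFamily (stair E) (xMin E) (dataOf z))) := by
  obtain ⟨I, hI⟩ := exists_biIdeal_eq
    (Ideal.span (Set.range (syzFamily (stair E) (xMin E) (dataOf z))))
  rw [cellIdeal_eq hmon hfin hE (I := I), hI]
  · rw [hI]; exact (hE.isCanonical z).noReduced_span
  · intro s hs
    rw [hI]
    exact corner_sub_tailPoly_mem_span hE z hs

theorem leadingIdeal_eq_baseChange_iff (hmon : IsMonomialIdeal E) (hE : IsStaircase E)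
    (I : Ideal (Poly K)) : leadingIdeal I = baseChange K E ↔
      (∃ F, IsAdapted (stair E) F ∧ ∀ s, F s ∈ biIdeal I) ∧ NoReduced (stair E) (biIdeal I) :=
  leadingIdeal_eq_iff (hmon.baseChange K) hE.antitone (fun a b => by
    rw [hmon.monomial_mem_baseChange_iff, hE.mem_iff]) I

theorem polyMap_cellParam_mem_cell (hmon : IsMonomialIdeal E)
    (hfin : Module.Finite k (Poly k ⧸ E)) (hE : IsStaircase E) (z : Fin (syzIndex E).card → K) :
    polyMap (cellParam E) K z ∈ cell E K := by
  rw [cell, Set.mem_ofPred_eq, leadingIdeal_eq_baseChange_iff hmon hE,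
    biIdeal_cellIdeal hmon hfin hE]
  exact ⟨⟨_, (hE.isCanonical z).adapted, IsCanonical.mem_span⟩, (hE.isCanonical z).noReduced_span⟩

/-- Reducing the Gröbner basis of the ideal gives a canonical family in it, and the family built
from `z` is another; by uniqueness their syzygies agree. -/
theorem polyMap_cellParamInv_cellParam (hE : IsStaircase E) (z : Fin (syzIndex E).card → K) :
    polyMap (cellParamInv E) K (polyMap (cellParam E) K z) = z := by
  have hG := isAdapted_stairFamily_tailPoly (polyMap (cellParam E) K z)
  have hGI := stairFamily_mem fun s => corner_sub_tailPoly_mem_span hE z (s := s)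
  have hcan := hG.isCanonical hE.antitone (hE.isCanonical z).noReduced_span hGI
  have hN := (hE.isCanonical z).unique hcan fun s => canonState_mem hGI s s
  rw [polyMap_cellParamInv hE]
  funext j
  rw [coeffData, hN _ _ (hE.mem_syzIndex.1 ((syzIndex E).equivFin.symm j).2).1, coeff_dataOf]

theorem IsCanonical.congr {A : Type*} [CommRing A] {h : ℕ → ℕ}
    {F : ℕ → Polynomial (Polynomial A)} {N N' : ℕ → ℕ → Polynomial A} (H : IsCanonical h F N)
    (hN : ∀ s l, l ≤ s + 1 → N' s l = N s l) : IsCanonical h F N' where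
  adapted := H.adapted
  degree_lt s l hl := by rw [hN s l hl]; exact H.degree_lt s l hl
  rel s := by
    rw [H.rel s, diagEntry, diagEntry, hN s _ le_rfl]
    congr 1
    exact Finset.sum_congr rfl fun l hl => by rw [hN s l (Finset.mem_range.1 hl).le]

/-- The canonical family of the ideal is recovered from its syzygies, so the corner polynomials
rebuilt from it lie in the original ideal, where their tails are unique. -/
theorem polyMap_cellParam_cellParamInv (hmon : IsMonomialIdeal E)
    (hfin : Module.Finite k (Poly k ⧸ E)) (hE : IsStaircase E) {c : Coord E → K}
    (hc : c ∈ cell E K) : polyMap (cellParam E) K (polyMap (cellParamInv E) K c) = c := by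
  rw [cell, Set.mem_ofPred_eq, leadingIdeal_eq_baseChange_iff hmon hE] at hc
  have hmem := fun s => corner_sub_tailPoly_mem hmon hfin hE c (s := s)
  have hGI := stairFamily_mem hmem
  have hG := isAdapted_stairFamily_tailPoly c
  have hcan := (hG.isCanonical hE.antitone hc.2 hGI).congr
    (N' := dataOf (polyMap (cellParamInv E) K c)) fun s l hl => by
      rw [polyMap_cellParamInv hE, dataOf_coeffData hE _ hl (hG.degree_canonData_lt hE.antitone)]
  have hF := hcan.eq_syzFamily hE.antitone hE.xMin_eq
  have hle : Ideal.span (Set.range (syzFamily (stair E) (xMin E)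
      (dataOf (polyMap (cellParamInv E) K c)))) ≤ biIdeal (cellIdeal E c) := by
    rw [← hF, Ideal.span_le]
    rintro _ ⟨s, rfl⟩
    exact canonState_mem hGI s s
  exact coord_unique hE hc.2 (fun s hs => hle (corner_sub_tailPoly_mem_span hE _ hs)) hmem

theorem bijOn_cellIdeal (hmon : IsMonomialIdeal E) (hfin : Module.Finite k (Poly k ⧸ E))
    (hE : IsStaircase E) (K : Type u) [Field K] [Algebra k K] :
    Set.BijOn (cellIdeal E (K := K)) (cell E K) (V₀ (baseChange K E)) := by
  refine ⟨fun c hc => hc, fun c hc c' hc' hcc' => ?_, fun I hI => ?_⟩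
  · rw [cell, Set.mem_ofPred_eq, leadingIdeal_eq_baseChange_iff hmon hE] at hc
    exact coord_unique hE hc.2 (fun s hs => corner_sub_tailPoly_mem hmon hfin hE c hs)
      fun s hs => by rw [hcc']; exact corner_sub_tailPoly_mem hmon hfin hE c' hs
  · have hI' := hI
    rw [V₀, Set.mem_ofPred_eq, leadingIdeal_eq_baseChange_iff hmon hE] at hI'
    obtain ⟨⟨F, hF, hFI⟩, hred⟩ := hI'
    have hc : cellIdeal E (coordOf E F) = I := cellIdeal_eq hmon hfin hE hred fun s hs => by
      rw [tailPoly_coordOf hE hF hs]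
      exact hF.corner_sub_mem hFI s
    exact ⟨coordOf E F, by rw [cell, Set.mem_ofPred_eq, hc]; exact hI, hc⟩

theorem mem_V₁_iff (hmon : IsMonomialIdeal E) (hfin : Module.Finite k (Poly k ⧸ E))
    (hE : IsStaircase E) (z : Fin (syzIndex E).card → K) :
    cellIdeal E (polyMap (cellParam E) K z) ∈ V₁ (baseChange K E) ↔
      ∀ j ∉ coordSubset E OffDiag, z j = 0 := by
  have H := hE.isCanonical z
  rw [V₁, Set.mem_ofPred_eq,
    and_iff_right (show leadingIdeal _ = _ from polyMap_cellParam_mem_cell hmon hfin hE z),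
    ← toBi_mem_radical_biIdeal, toBi_X_one, biIdeal_cellIdeal hmon hfin hE,
    H.C_X_mem_radical_iff hE.antitone hE.xMin_eq, forall_notMem_coordSubset_iff hE]
  constructor
  · rintro hN s l - e he rfl
    exact he (by rw [hN, Polynomial.coeff_zero])
  · intro hN s
    ext e
    by_contra he
    exact hN s (s + 1) le_rfl e he rfl

theorem mem_V₂_iff (hmon : IsMonomialIdeal E) (hfin : Module.Finite k (Poly k ⧸ E))
    (hE : IsStaircase E) (hne : E ≠ ⊤) (z : Fin (syzIndex E).card → K) :
    cellIdeal E (polyMap (cellParam E) K z) ∈ V₂ (baseChange K E) ↔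
      ∀ j ∉ coordSubset E (NotUnipotent (stair E)), z j = 0 := by
  have H := hE.isCanonical z
  have hcell : leadingIdeal (cellIdeal E (polyMap (cellParam E) K z)) = baseChange K E :=
    polyMap_cellParam_mem_cell hmon hfin hE z
  have htop : cellIdeal E (polyMap (cellParam E) K z) ≠ ⊤ := fun h => by
    -- Since `E ≠ ⊤` gives `stair E 0 > 0`, the constant `1` is reduced and cannot lie in the ideal.
    have hred := ((leadingIdeal_eq_baseChange_iff hmon hE _).1 hcell).2 1 (by
      rw [← map_one toBi, toBi_mem_biIdeal, h]; exact Submodule.mem_top) fun s => by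
        rw [Polynomial.coeff_one]
        split_ifs with hs
        · rw [hs, Polynomial.degree_one]
          exact Nat.cast_pos.2 (hE.pos 0 (hE.xMin_pos hne))
        · rw [Polynomial.degree_zero]
          exact WithBot.bot_lt_coe _
    exact one_ne_zero hred
  rw [V₂, Set.mem_ofPred_eq, and_iff_right hcell, radical_eq_span_iff htop,
    ← toBi_mem_radical_biIdeal, ← toBi_mem_radical_biIdeal, toBi_X_one, toBi_X_zero,
    biIdeal_cellIdeal hmon hfin hE,
    H.C_X_mem_radical_iff hE.antitone hE.xMin_eq, forall_notMem_coordSubset_iff hE]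
  constructor
  · rintro ⟨hN, hx⟩ s l hl e he
    rw [H.X_mem_radical_iff hE.antitone hE.xMin_eq hE.pos hN] at hx
    have hls : l ≠ s + 1 := by
      rintro rfl
      exact he (by rw [hN, Polynomial.coeff_zero])
    refine ⟨hls, ?_⟩
    rintro ⟨rfl, h2⟩
    exact he (hx s l (by omega) h2)
  · intro hN
    have hdiag : ∀ s, dataOf z s (s + 1) = 0 := fun s => by
      ext e
      by_contra he
      exact (hN s (s + 1) le_rfl e he).1 rfl
    refine ⟨hdiag, ?_⟩
    rw [H.X_mem_radical_iff hE.antitone hE.xMin_eq hE.pos hdiag]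
    intro s l hl h2
    by_contra he
    exact (hN s l (by omega) 0 he).2 ⟨rfl, h2⟩

theorem mem_V₃_iff (hmon : IsMonomialIdeal E) (hfin : Module.Finite k (Poly k ⧸ E))
    (hE : IsStaircase E) (z : Fin (syzIndex E).card → K) :
    cellIdeal E (polyMap (cellParam E) K z) ∈ V₃ (baseChange K E) ↔
      ∀ j ∉ coordSubset E (HomogIndex (stair E)), z j = 0 := by
  have H := hE.isCanonical z
  have hI := biIdeal_cellIdeal hmon hfin hE z
  rw [V₃, Set.mem_ofPred_eq,
    and_iff_right (show leadingIdeal _ = _ from polyMap_cellParam_mem_cell hmon hfin hE z),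
    forall_notMem_coordSubset_iff hE]
  constructor
  · intro hhom
    refine H.isHomogData hE.antitone hE.xMin_eq fun n f hf => ?_
    rw [← hI] at hf ⊢
    exact homogPart_mem_biIdeal hhom n hf
  · intro hN
    exact isHomogeneous_of_biIdeal_eq_span hI
      (H.isHomog_of_isHomogData hE.antitone hE.xMin_eq hN)

end Parametrization

end GroebnerCell

theorem corollary3p1 {k : Type u} [Field k] (E : Ideal (GroebnerCell.Poly k))
    (hmon : GroebnerCell.IsMonomialIdeal E)
    (hfin : Module.Finite k (GroebnerCell.Poly k ⧸ E))
    (hne : E ≠ ⊤) :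
    -- the points of the affine variety correspond to the ideals in `V₀`
    (∀ (K : Type u) [Field K] [Algebra k K],
      Set.BijOn (GroebnerCell.cellIdeal E (K := K)) (GroebnerCell.cell E K)
        (GroebnerCell.V₀ (GroebnerCell.baseChange K E))) ∧
    ∃ (n : ℕ) (P : GroebnerCell.Coord E → MvPolynomial (Fin n) k)
      (Q : Fin n → MvPolynomial (GroebnerCell.Coord E) k) (J₁ J₂ J₃ : Finset (Fin n)),
      -- the dimensions
      n = Module.finrank k (GroebnerCell.Poly k ⧸ E) + GroebnerCell.yMin E ∧
      J₁.card = Module.finrank k (GroebnerCell.Poly k ⧸ E) ∧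
      J₂.card + GroebnerCell.xMin E = Module.finrank k (GroebnerCell.Poly k ⧸ E) ∧
      J₃.card = (GroebnerCell.indexSet E).ncard ∧
      ∀ (K : Type u) [Field K] [Algebra k K],
        -- `P` and `Q` are mutually inverse isomorphisms between `𝔸ⁿ` and the variety
        (∀ z : Fin n → K, GroebnerCell.polyMap P K z ∈ GroebnerCell.cell E K) ∧
        (∀ z : Fin n → K, GroebnerCell.polyMap Q K (GroebnerCell.polyMap P K z) = z) ∧
        (∀ c ∈ GroebnerCell.cell E K, GroebnerCell.polyMap P K (GroebnerCell.polyMap Q K c) = c) ∧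
        -- the three subsets are coordinate subspaces
        (∀ z : Fin n → K,
          GroebnerCell.cellIdeal E (GroebnerCell.polyMap P K z) ∈
            GroebnerCell.V₁ (GroebnerCell.baseChange K E) ↔ ∀ j ∉ J₁, z j = 0) ∧
        (∀ z : Fin n → K,
          GroebnerCell.cellIdeal E (GroebnerCell.polyMap P K z) ∈
            GroebnerCell.V₂ (GroebnerCell.baseChange K E) ↔ ∀ j ∉ J₂, z j = 0) ∧
        (∀ z : Fin n → K,
          GroebnerCell.cellIdeal E (GroebnerCell.polyMap P K z) ∈
            GroebnerCell.V₃ (GroebnerCell.baseChange K E) ↔ ∀ j ∉ J₃, z j = 0) := by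
  have hE := hmon.isStaircase hfin
  have hdim := hmon.finrank_eq.trans hE.ncard_compl
  refine ⟨fun K _ _ => GroebnerCell.bijOn_cellIdeal hmon hfin hE K,
    (GroebnerCell.syzIndex E).card, GroebnerCell.cellParam E, GroebnerCell.cellParamInv E,
    GroebnerCell.coordSubset E GroebnerCell.OffDiag,
    GroebnerCell.coordSubset E (GroebnerCell.NotUnipotent (GroebnerCell.stair E)),
    GroebnerCell.coordSubset E (GroebnerCell.HomogIndex (GroebnerCell.stair E)),
    ?_, ?_, ?_, hE.card_homogIndex, fun K _ _ => ⟨?_, ?_, ?_, ?_, ?_, ?_⟩⟩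
  · rw [hE.card_syzIndex, hdim, GroebnerCell.yMin_eq]
  · rw [hE.card_offDiag, hdim]
  · rw [hE.card_notUnipotent, hdim]
  · exact GroebnerCell.polyMap_cellParam_mem_cell hmon hfin hE
  · exact GroebnerCell.polyMap_cellParamInv_cellParam hE
  · exact fun c hc => GroebnerCell.polyMap_cellParam_cellParamInv hmon hfin hE hc
  · exact GroebnerCell.mem_V₁_iff hmon hfin hE
  · exact GroebnerCell.mem_V₂_iff hmon hfin hE hne
  · exact GroebnerCell.mem_V₃_iff hmon hfin hE
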